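/- **Objects.** A clause is a finite set of literals, a (CNF) formula $F$ is a finite set of clauses, $\mathrm{var}(\cdot)$ denotes the set of occurring variables, and $J\subseteq\mathrm{var}(F)$ is a model of $F$, $J\models F$, if setting exactly the variables in $J$ to $1$ satisfies $F$. An instance of the projected model counting problem PMC is a pair $(F,P)$ with $P\subseteq\mathrm{var}(F)$; the task is to output its projected model count $|\{J\cap P : J\subseteq\mathrm{var}(F),\ J\models F\}|$. The primal graph of $F$ has vertex set $\mathrm{var}(F)$, with distinct variables adjacent if they occur in a common clause. A nice tree decomposition $\mathcal T=(T,\chi)$ of $F$ is a tree decomposition of the primal graph over a finite rooted ordered tree $T$ with root $n$, in which the bags of the leaves and of the root are empty and every node $t$ is a leaf, a join node (two children, both with the same non-empty bag as $t$), an introduce node (one child $t'$, $\chi(t)=\chi(t')\cup\{a\}$, $a\notin\chi(t')$) or a removal node (one child $t'$, $\chi(t)=\chi(t')\setminus\{a\}$, $a\in\chi(t')$). **First pass.** SAT computes bottom-up tables $\tau_t$ of sets of variables: $\tau_t=\{\emptyset\}$ at a leaf; $\tau_t=\{K : J\in\tau_{t'},\ K\in\{J,J\cup\{a\}\},\ K\models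 F_t\}$ at an introduce node, where $F_t=\{c\in F:\mathrm{var}(c)\subseteq\chi(t)\}$; $\tau_t=\{J\setminus\{a\}:J\in\tau_{t'}\}$ at a removal node; $\tau_t=\tau_{t'}\cap\tau_{t''}$ at a join node with children $t',t''$. For a node $t$ with children $t_1,\dots,t_\ell$, the origins of a row $u$ are the sequences $(s_1,\dots,s_\ell)\in\tau_{t_1}\times\cdots\times\tau_{t_\ell}$ such that $u$ belongs to the table that SAT computes at $t$ from the child tables $\{s_1\},\dots,\{s_\ell\}$. The extensions below $t$ of $u\in\tau_t$ are the sets of pairs (node, row) that consist of $(t,u)$ and, for some origin $(s_1,\dots,s_\ell)$ of $u$, of an extension below $t_i$ of $s_i$ for each $i$. **Purging.** $\tau^*_t$ is the set of rows $u\in\tau_t$ such that $(t,u)$ belongs to an extension below $t$ that is contained in some extension below the root $n$ of a row of $\tau_n$. **Second pass.** $\mathrm{DP}_{\mathrm{PROJ}}$, given the tables $\tau^*$, computes bottom-up tables $\iota_t=\{(\sigma,\mathrm{ipmc}_t(\sigma))\}$, where $\sigma$ ranges over the non-empty sets of rows of $\tau^*_t$ that have pairwise the same intersection with $P$. Here $\mathrm{ipmc}_t(\sigma)=1$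 if $t$ is a leaf, and otherwise $$\mathrm{ipmc}_t(\sigma)=\Bigl|\,\mathrm{pcnt}_t(\sigma)+\sum_{\emptyset\subsetneq\rho\subsetneq\sigma}(-1)^{|\rho|}\,\mathrm{ipmc}_t(\rho)\Bigr|,\qquad \mathrm{pcnt}_t(\sigma)=\sum_{\emptyset\ne O\subseteq\mathrm{orig}_t(\sigma)}(-1)^{|O|-1}\prod_{i=1}^{\ell}\mathrm{sipmc}(\iota_{t_i},O_{(i)}),$$ where $\mathrm{orig}_t(\sigma)$ is the set of all origins, with respect to the tables $\tau^*$, of rows in $\sigma$, $O_{(i)}$ is the set of $i$-th components of the sequences in $O$, and $\mathrm{sipmc}(\iota,\sigma)=\sum_{(\sigma,c)\in\iota}c$ is the counter stored for $\sigma$ in $\iota$ ($0$ if there is none). **Theorem.** Let $(F,P)$ be an instance of PMC, where $F$ is not the formula $\{\emptyset\}$ whose only clause is the empty clause. 1. For every nice tree decomposition of $F$ with root $n$, the root table computed by $\mathrm{DP}_{\mathrm{PROJ}}$ from the purged SAT tables satisfies $$\mathrm{sipmc}(\iota_n,\tau^*_n)=\mathrm{sipmc}(\iota_n,\{\emptyset\})=|\{J\cap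 P : J\subseteq\mathrm{var}(F),\ J\models F\}|.$$ 2. Hence the whole algorithm (choose a nice tree decomposition of $F$, run the first pass, purge, run the second pass, output $\mathrm{sipmc}(\iota_n,\tau^*_n)$) solves PMC: a nice tree decomposition of $F$ exists, and whichever is used, the output is the projected model count of $(F,P)$. -/

import Mathlib

namespace ProjCount

universe u v

/-! ### Propositional formulas and projected model counting -/

/-- A literal: `(x, true)` is the variable `x`, `(x, false)` is its negation. -/
abbrev Literal (V : Type u) := V × Bool

/-- A clause is a finite set of literals, read as their disjunction. -/
abbrev Clause (V : Type u) := Finset (Literal V)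

/-- A formula (in CNF) is a finite set of clauses, read as their conjunction. -/
abbrev Formula (V : Type u) := Finset (Clause V)

section Formulas

variable {V : Type u} [DecidableEq V]

/-- The variables of a clause. -/
def clauseVars (c : Clause V) : Finset V := c.image Prod.fst

/-- The variables of a formula. -/
def vars (F : Formula V) : Finset V := F.biUnion clauseVars

/-- `J ⊨ F`: under the assignment that maps exactly the variables in `J` to `1`, every clause of `F`
contains a literal set to `1`. -/
def Models (J : Finset V) (F : Formula V) : Prop :=
  ∀ c ∈ F, ∃ l ∈ c, (l.1 ∈ J ↔ l.2 = true)

instance (J : Finset V) (F : Formula V) : Decidable (Models J F) := by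
  unfold Models; infer_instance

/-- The set of all models `J ⊆ var(F)` of `F`. -/
def models (F : Formula V) : Finset (Finset V) := (vars F).powerset.filter fun J => Models J F

/-- The projected model count of `F` with respect to `P`: the number of distinct sets `J ∩ P`, where
`J` runs over the models of `F`. -/
def projectedModelCount (F : Formula V) (P : Finset V) : ℕ :=
  ((models F).image fun J => J ∩ P).card

/-- Adjacency in the primal graph of `F`, whose set of vertices is `vars F`: two distinct variables
are joined by an edge if they occur together in a clause. -/
def primalGraph (F : Formula V) : SimpleGraph V where
  Adj x y := x ≠ y ∧ ∃ c ∈ F, x ∈ clauseVars c ∧ y ∈ clauseVars c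
  symm := ⟨fun _ _ h => ⟨h.1.symm, h.2.imp fun _ hc => ⟨hc.1, hc.2.2, hc.2.1⟩⟩⟩
  loopless := ⟨fun _ h => h.1 rfl⟩

end Formulas

/-! ### Rooted trees and nice tree decompositions -/

/-- A rooted tree on the set of nodes `N`, with the children of each node listed in a fixed order. -/
structure RootedTree (N : Type v) where
  root : N
  children : N → List N
  nodup_children : ∀ t, (children t).Nodup
  root_notMem_children : ∀ t, root ∉ children t
  parent_unique : ∀ s t c, c ∈ children s → c ∈ children t → s = t
  reachable : ∀ t, Relation.ReflTransGen (fun s c => c ∈ children s) root t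

namespace RootedTree

variable {N : Type v} (T : RootedTree N)

/-- The underlying undirected tree. -/
def graph : SimpleGraph N := SimpleGraph.fromRel fun s c => c ∈ T.children s

theorem not_transGen_self (t : N) : ¬ Relation.TransGen (fun c s => c ∈ T.children s) t t := by
  induction T.reachable t with
  | refl =>
    intro h
    obtain ⟨b, hb, -⟩ := Relation.TransGen.head'_iff.1 h
    exact T.root_notMem_children _ hb
  | @tail s c _ hc ih =>
    intro h
    obtain ⟨b, hb, hbc⟩ := Relation.TransGen.head'_iff.1 h
    obtain rfl := T.parent_unique _ _ _ hb hc
    exact ih (Relation.TransGen.tail' hbc hc)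

theorem wellFounded_child [Finite N] : WellFounded (fun c s => c ∈ T.children s) := by
  have : Std.Irrefl (Relation.TransGen (fun c s => c ∈ T.children s)) := ⟨T.not_transGen_self⟩
  exact Subrelation.wf (fun h => Relation.TransGen.single h)
    (Finite.wellFounded_of_trans_of_irrefl (Relation.TransGen (fun c s => c ∈ T.children s)))

/-- Dynamic programming along the tree: the nodes are visited in post-order, and the value at a node
`t` is computed by `A` from `t` and the sequence of the values at the children of `t`. -/
noncomputable def dp [Finite N] {α : Type*} (A : N → List α → α) : N → α :=
  T.wellFounded_child.fix fun t ih => A t ((T.children t).attach.map fun c => ih c.1 c.2)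

theorem dp_eq [Finite N] {α : Type*} (A : N → List α → α) (t : N) :
    T.dp A t = A t ((T.children t).map (T.dp A)) := by
  rw [dp, WellFounded.fix_eq]
  congr 1
  exact List.attach_map_val (l := T.children t) (f := T.dp A)

end RootedTree

section TreeDecompositions

variable {V : Type u} [DecidableEq V] {N : Type v}

/-- `(T, χ)` is a tree decomposition of the graph with vertex set `U` and adjacency `G`. -/
structure IsTreeDecomposition (U : Finset V) (G : SimpleGraph V) (T : RootedTree N)
    (χ : N → Finset V) : Prop where
  bag_subset : ∀ t, χ t ⊆ U
  vertex_covered : ∀ x ∈ U, ∃ t, x ∈ χ t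
  edge_covered : ∀ x y, G.Adj x y → ∃ t, x ∈ χ t ∧ y ∈ χ t
  path_inter_subset : ∀ (r s t : N) (p : T.graph.Walk r t), p.IsPath → s ∈ p.support →
    χ r ∩ χ t ⊆ χ s

/-- The bag of `t` is the bag of `t'` with one introduced vertex. -/
def Introduces (χ : N → Finset V) (t t' : N) : Prop :=
  χ t' ⊆ χ t ∧ (χ t).card = (χ t').card + 1

/-- The bag of `t` is the bag of `t'` with one vertex removed. -/
def Removes (χ : N → Finset V) (t t' : N) : Prop :=
  χ t ⊆ χ t' ∧ (χ t').card = (χ t).card + 1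

instance (χ : N → Finset V) (t t' : N) : Decidable (Introduces χ t t') := by
  unfold Introduces; infer_instance

instance (χ : N → Finset V) (t t' : N) : Decidable (Removes χ t t') := by
  unfold Removes; infer_instance

def IsLeaf (T : RootedTree N) (t : N) : Prop := T.children t = []

def IsJoin (T : RootedTree N) (χ : N → Finset V) (t : N) : Prop :=
  ∃ t' t'', T.children t = [t', t''] ∧ χ t = χ t' ∧ χ t = χ t'' ∧ (χ t).Nonempty

def IsInt (T : RootedTree N) (χ : N → Finset V) (t : N) : Prop :=
  ∃ t', T.children t = [t'] ∧ Introduces χ t t'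

def IsRem (T : RootedTree N) (χ : N → Finset V) (t : N) : Prop :=
  ∃ t', T.children t = [t'] ∧ Removes χ t t'

/-- `(T, χ)` is a nice tree decomposition of the formula `F`, that is, of its primal graph. -/
structure IsNiceTreeDecomposition (F : Formula V) (T : RootedTree N) (χ : N → Finset V) : Prop where
  isTreeDecomposition : IsTreeDecomposition (vars F) (primalGraph F) T χ
  node_type : ∀ t, IsLeaf T t ∨ IsJoin T χ t ∨ IsInt T χ t ∨ IsRem T χ t
  bag_leaf : ∀ t, IsLeaf T t → χ t = ∅
  bag_root : χ T.root = ∅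

end TreeDecompositions

/-! ### First pass: the tables of the algorithm for SAT -/

/-- A row of a SAT-table consists of one interpretation. -/
abbrev Row (V : Type u) := Finset V

/-- A SAT-table is a finite set of rows. -/
abbrev Table (V : Type u) := Finset (Row V)

/-- The product `τ₁ × ⋯ × τₗ` of a sequence of finite sets, as a set of sequences. -/
def seqProd {α : Type*} [DecidableEq α] : List (Finset α) → Finset (List α)
  | [] => {[]}
  | τ :: τs => (τ ×ˢ seqProd τs).image fun p => p.1 :: p.2

section Sat

variable {V : Type u} [DecidableEq V] {N : Type v}

/-- The clauses of `F` all of whose variables are in the given bag. -/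
def bagFormula (F : Formula V) (bag : Finset V) : Formula V :=
  F.filter fun c => clauseVars c ⊆ bag

/-- The table algorithm SAT at the node `t`, applied to the sequence `Tab` of the tables of the
children of `t`. If `t` introduces the variable `a`, then `χ t \ χ t' = {a}`; if `t` removes `a`,
then `χ t' \ χ t = {a}`. -/
def sat (F : Formula V) (T : RootedTree N) (χ : N → Finset V) (t : N) (Tab : List (Table V)) :
    Table V :=
  match T.children t, Tab with
  | [], _ => {∅}
  | [t'], [τ'] =>
    if Introduces χ t t' then
      τ'.biUnion fun J =>
        ({J, J ∪ (χ t \ χ t')} : Finset (Row V)).filter fun K => Models K (bagFormula F (χ t))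
    else if Removes χ t t' then
      τ'.image fun J => J \ (χ t' \ χ t)
    else ∅
  | [_, _], [τ', τ''] => τ' ∩ τ''
  | _, _ => ∅

/-- The SAT-tables of all nodes. -/
noncomputable def dpSat [Finite N] (F : Formula V) (T : RootedTree N) (χ : N → Finset V) :
    N → Table V :=
  T.dp (sat F T χ)

/-- The origins of the row `u` at the node `t`, with respect to the tables `τ`: the sequences of rows
of the children of `t` from which SAT obtains `u`. -/
def orig (F : Formula V) (T : RootedTree N) (χ : N → Finset V) (τ : N → Table V) (t : N)
    (u : Row V) : Finset (List (Row V)) :=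
  (seqProd ((T.children t).map τ)).filter fun s => u ∈ sat F T χ t (s.map fun r => {r})

/-- The origins of a table `σ` at the node `t`. -/
def origs (F : Formula V) (T : RootedTree N) (χ : N → Finset V) (τ : N → Table V) (t : N)
    (σ : Table V) : Finset (List (Row V)) :=
  σ.biUnion fun u => orig F T χ τ t u

/-! ### Extensions and purging -/

/-- The extensions below `t` of a row `u` of the SAT-table of `t`. -/
noncomputable def ext [Finite N] (F : Formula V) (T : RootedTree N) (χ : N → Finset V) :
    N → Row V → Set (Set (N × Row V)) :=
  T.dp fun t exts u =>
    if (T.children t).isEmpty then {{(t, u)}}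
    else {X | ∃ v ∈ orig F T χ (dpSat F T χ) t u, ∃ Xs : List (Set (N × Row V)),
      List.Forall₂ (fun Xi Ei => Xi ∈ Ei) Xs (List.zipWith (fun e r => e r) exts v) ∧
        X = {(t, u)} ∪ Xs.foldr (fun A B => A ∪ B) ∅}

/-- All extensions below the root of rows of the SAT-table of the root. -/
def rootExts [Finite N] (F : Formula V) (T : RootedTree N) (χ : N → Finset V) :
    Set (Set (N × Row V)) :=
  ⋃ u ∈ dpSat F T χ T.root, ext F T χ T.root u

/-- The satisfiable extensions below `t` of a table `σ`: those contained in an extension below the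
root. -/
def satExt [Finite N] (F : Formula V) (T : RootedTree N) (χ : N → Finset V) (t : N) (σ : Table V) :
    Set (Set (N × Row V)) :=
  ⋃ u ∈ σ, {X | X ∈ ext F T χ t u ∧ ∃ Y ∈ rootExts F T χ, X ⊆ Y}

open Classical in
/-- The purged SAT-tables: only rows that occur in a satisfiable extension are kept. -/
noncomputable def purgedSat [Finite N] (F : Formula V) (T : RootedTree N) (χ : N → Finset V)
    (t : N) : Table V :=
  (dpSat F T χ t).filter fun u => ∃ X ∈ satExt F T χ t (dpSat F T χ t), (t, u) ∈ X

end Sat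

/-! ### Second pass: the tables of the algorithm PROJ -/

/-- A PROJ-table is a finite set of pairs of a SAT-table and a counter. -/
abbrev ProjTable (V : Type u) := Finset (Table V × ℕ)

section Proj

variable {V : Type u} [DecidableEq V] {N : Type v}

/-- The equivalence classes of the rows of `τ` modulo equality on `P`. -/
def buckets (P : Finset V) (τ : Table V) : Finset (Table V) :=
  τ.image fun u => τ.filter fun w => w ∩ P = u ∩ P

/-- The non-empty subsets of the equivalence classes. -/
def subBuckets (P : Finset V) (τ : Table V) : Finset (Table V) :=
  τ.powerset.filter fun S => S.Nonempty ∧ ∃ B ∈ buckets P τ, S ⊆ B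

/-- The counter stored for the table `σ` in the PROJ-table `ι`. -/
def sipmc (ι : ProjTable V) (σ : Table V) : ℕ :=
  ∑ p ∈ ι.filter (fun p => p.1 = σ), p.2

/-- The product of the counters stored for the components of a set `O` of sequences of rows. -/
def sipmcSeq (Tab : List (ProjTable V)) (O : Finset (List (Row V))) : ℕ :=
  ∏ i : Fin Tab.length, sipmc Tab[i] (O.image fun s => s.getD i ∅)

/-- The (inductive) projected model count of the table `σ` at `t`. -/
def pcnt (F : Formula V) (T : RootedTree N) (χ : N → Finset V) (τ : N → Table V) (t : N)
    (σ : Table V) (Tab : List (ProjTable V)) : ℤ :=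
  ∑ O ∈ (origs F T χ τ t σ).powerset.filter (fun O => O.Nonempty),
    (-1) ^ (O.card - 1) * (sipmcSeq Tab O : ℤ)

/-- The (recursive) intersection projected model count of the table `σ` at `t`. -/
def ipmc (F : Formula V) (T : RootedTree N) (χ : N → Finset V) (τ : N → Table V) (t : N)
    (σ : Table V) (Tab : List (ProjTable V)) : ℕ :=
  if (T.children t).isEmpty then 1
  else
    (pcnt F T χ τ t σ Tab +
      ∑ ρ ∈ (σ.ssubsets.filter fun ρ => ρ.Nonempty).attach,
        (-1) ^ ρ.1.card * (ipmc F T χ τ t ρ.1 Tab : ℤ)).natAbs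
termination_by σ.card
decreasing_by
  exact Finset.card_lt_card (Finset.mem_ssubsets.1 (Finset.mem_filter.1 ρ.2).1)

theorem ipmc_eq (F : Formula V) (T : RootedTree N) (χ : N → Finset V) (τ : N → Table V) (t : N)
    (σ : Table V) (Tab : List (ProjTable V)) :
    ipmc F T χ τ t σ Tab =
      if (T.children t).isEmpty then 1
      else
        (pcnt F T χ τ t σ Tab +
          ∑ ρ ∈ σ.ssubsets.filter (fun ρ => ρ.Nonempty),
            (-1) ^ ρ.card * (ipmc F T χ τ t ρ Tab : ℤ)).natAbs := by
  rw [ipmc, Finset.sum_attach (σ.ssubsets.filter fun ρ => ρ.Nonempty)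
    (fun ρ => (-1) ^ ρ.card * (ipmc F T χ τ t ρ Tab : ℤ))]

/-- The table algorithm PROJ at the node `t`, given the SAT-tables `τ` of all nodes and the sequence
`Tab` of the PROJ-tables of the children of `t`. -/
def proj (F : Formula V) (P : Finset V) (T : RootedTree N) (χ : N → Finset V) (τ : N → Table V)
    (t : N) (Tab : List (ProjTable V)) : ProjTable V :=
  (subBuckets P (τ t)).image fun σ => (σ, ipmc F T χ τ t σ Tab)

/-- The PROJ-tables of all nodes, computed from given SAT-tables `τ`. -/
noncomputable def dpProj [Finite N] (F : Formula V) (P : Finset V) (T : RootedTree N)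
    (χ : N → Finset V) (τ : N → Table V) : N → ProjTable V :=
  T.dp (proj F P T χ τ)

/-- The number printed by the whole algorithm (first pass, purging, second pass) when it works on the
tree decomposition `(T, χ)`: the counter stored at the root for the purged SAT-table of the root. -/
noncomputable def mdpOutput [Finite N] (F : Formula V) (P : Finset V) (T : RootedTree N)
    (χ : N → Finset V) : ℕ :=
  sipmc (dpProj F P T χ (purgedSat F T χ) T.root) (purgedSat F T χ T.root)

/-- The whole algorithm can output `c` on the instance `(F, P)`: there is a nice tree decomposition
of `F`, which may be the one that the algorithm computes, from which it obtains `c`. -/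
def MdpOutputs (F : Formula V) (P : Finset V) (c : ℕ) : Prop :=
  ∃ (m : ℕ) (T : RootedTree (Fin m)) (χ : Fin m → Finset V),
    IsNiceTreeDecomposition F T χ ∧ mdpOutput F P T χ = c

end Proj

end ProjCount

/-! Write `B t` for the variables in the bags of the subtree of `t` (`below`). For a row `u` at `t`,
let `parts t u` be the set of all `J ∩ B t ∩ P`, where `J` is a model with `J ∩ χ t = u`. The
invariant of the second pass is `sipmc_dpProj`: the counter for a non-empty set `σ` of purged rows
is the size of the intersection of `parts t u` over `u ∈ σ`. At the root the bag is empty and `B` is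
`vars F`, so the counter of `{∅}` is the projected model count.

Two facts about the decomposition carry the invariant. Purged rows are exactly the restrictions of
models to the bag (`mem_purgedSat`): compatible rows of an extension merge into one assignment, and
every clause is checked at an introduce node. This is where `F ≠ {∅}` enters, since without
variables there are no introduce nodes. Moreover, a bag separates its subtree from the rest, so two
models that agree on it can be glued (`glue_mem_models`). Hence the union of `parts t u` over `σ`
has as many elements as the union, over the origins of `σ`, of the parts (at a join, pairs of parts)
of the children; this is proved in the three lemmas `card_biUnion_origs_of_*`.

The rest is inclusion-exclusion. `pcnt` computes the size of that union from the intersections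
stored at the children, and `ipmc` solves the same identity for the intersection over all of `σ`.
Rows that differ on `P` have disjoint sets of parts, which matches the value `0` of a missing
counter. -/

namespace ProjCount

universe u v

/-! ### The subtree below a node -/

namespace RootedTree

variable {N : Type v} (T : RootedTree N)

/-- `s` is in the subtree with root `t`. -/
def Desc (t s : N) : Prop := Relation.ReflTransGen (fun s c => c ∈ T.children s) t s

variable {T}

theorem Desc.refl (t : N) : T.Desc t t := Relation.ReflTransGen.refl

theorem Desc.trans {r s t : N} (h : T.Desc r s) (h' : T.Desc s t) : T.Desc r t :=
  Relation.ReflTransGen.trans h h'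

theorem Desc.of_child {t c : N} (h : c ∈ T.children t) : T.Desc t c :=
  Relation.ReflTransGen.single h

theorem desc_iff {t s : N} : T.Desc t s ↔ s = t ∨ ∃ c ∈ T.children t, T.Desc c s := by
  constructor
  · intro h
    rcases Relation.ReflTransGen.cases_head h with h | ⟨c, hc, h⟩
    · exact Or.inl h.symm
    · exact Or.inr ⟨c, hc, h⟩
  · rintro (rfl | ⟨c, hc, h⟩)
    · exact Desc.refl _
    · exact (Desc.of_child hc).trans h

theorem not_desc_child {t c : N} (h : c ∈ T.children t) : ¬ T.Desc c t := by
  intro h'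
  have h1 : Relation.ReflTransGen (fun c s => c ∈ T.children s) t c :=
    Relation.reflTransGen_swap.1 h'
  exact T.not_transGen_self t (Relation.TransGen.tail' h1 h)

/-- A node in the subtree of `c` with a parent outside of it is `c`. -/
theorem eq_of_desc_of_child {c s p : N} (hs : T.Desc c s) (hp : ¬ T.Desc c p)
    (h : s ∈ T.children p) : s = c := by
  rcases Relation.ReflTransGen.cases_tail hs with h' | ⟨q, hq, h'⟩
  · exact h'
  · obtain rfl := T.parent_unique _ _ _ h h'
    exact absurd hq hp

/-- Going down from `c`, the subtree of `d` could only be entered at `d`, hence from the common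
parent `t`; but `t` is not below its child `c`. -/
theorem not_desc_of_siblings {t c d s : N} (hc : c ∈ T.children t) (hd : d ∈ T.children t)
    (hcd : c ≠ d) (h : T.Desc c s) : ¬ T.Desc d s := by
  intro h'
  induction h with
  | refl => exact hcd (eq_of_desc_of_child h' (not_desc_child hd) hc)
  | @tail p s hp hs ih =>
    by_cases hdp : T.Desc d p
    · exact ih hdp
    · have := eq_of_desc_of_child h' hdp hs
      subst this
      obtain rfl := T.parent_unique _ _ _ hs hd
      exact not_desc_child hc hp

theorem reachable_graph (s t : N) : T.graph.Reachable s t := by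
  have key : ∀ s, T.graph.Reachable T.root s := by
    intro s
    induction T.reachable s with
    | refl => exact SimpleGraph.Reachable.refl _
    | @tail p s _ hs ih =>
      refine ih.trans (SimpleGraph.Adj.reachable ((SimpleGraph.fromRel_adj _ _ _).2 ⟨?_, Or.inl hs⟩))
      rintro rfl
      exact not_desc_child hs (Desc.refl _)
  exact (key s).symm.trans (key t)

/-- A walk that leaves the subtree of `t` visits `t` and its parent. -/
theorem mem_support_of_leaves {t s r : N} (p : T.graph.Walk s r) (hs : T.Desc t s)
    (hr : ¬ T.Desc t r) : t ∈ p.support ∧ ∀ q, t ∈ T.children q → q ∈ p.support := by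
  obtain ⟨d, hd, h1, h2⟩ := p.exists_boundary_dart {x | T.Desc t x} hs hr
  have h1 : T.Desc t d.fst := h1
  have h2 : ¬ T.Desc t d.snd := h2
  have hadj := (SimpleGraph.fromRel_adj _ _ _).1 d.adj
  have hc : d.fst ∈ T.children d.snd := by
    -- A downward edge would stay in the subtree, so the boundary edge goes up to the parent.
    rcases hadj.2 with h | h
    · exact absurd (h1.trans (Desc.of_child h)) h2
    · exact h
  have he := eq_of_desc_of_child h1 h2 hc
  constructor
  · rw [← he]
    exact p.dart_fst_mem_support_of_mem_darts hd
  · intro q hq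
    rw [← he] at hq
    rw [T.parent_unique _ _ _ hq hc]
    exact p.dart_snd_mem_support_of_mem_darts hd

end RootedTree

/-! ### Nice tree decompositions -/

section Decompositions

variable {V : Type u} [DecidableEq V] {N : Type v} {F : Formula V} {T : RootedTree N}
  {χ : N → Finset V}

open Classical in
/-- The variables in the bags of the subtree of `t`. -/
noncomputable def below (F : Formula V) (T : RootedTree N) (χ : N → Finset V) (t : N) : Finset V :=
  (vars F).filter fun x => ∃ s, T.Desc t s ∧ x ∈ χ s

/-- The bag of a node separates the variables of its subtree from the others. -/
theorem IsTreeDecomposition.mem_bag_of_leaves {U : Finset V} {G : SimpleGraph V}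
    (h : IsTreeDecomposition U G T χ) {t s r : N} {x : V} (hs : T.Desc t s) (hr : ¬ T.Desc t r)
    (hxs : x ∈ χ s) (hxr : x ∈ χ r) : x ∈ χ t ∧ ∀ q, t ∈ T.children q → x ∈ χ q := by
  obtain ⟨p, hp⟩ := (T.reachable_graph s r).exists_isPath
  obtain ⟨h1, h2⟩ := RootedTree.mem_support_of_leaves p hs hr
  have hx : x ∈ χ s ∩ χ r := Finset.mem_inter.2 ⟨hxs, hxr⟩
  exact ⟨h.path_inter_subset _ _ _ p hp h1 hx,
    fun q hq => h.path_inter_subset _ _ _ p hp (h2 q hq) hx⟩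

namespace IsNiceTreeDecomposition

variable (h : IsNiceTreeDecomposition F T χ)
include h

theorem mem_below {t : N} {x : V} : x ∈ below F T χ t ↔ ∃ s, T.Desc t s ∧ x ∈ χ s := by
  classical
  rw [below, Finset.mem_filter, and_iff_right_iff_imp]
  rintro ⟨s, -, hs⟩
  exact h.isTreeDecomposition.bag_subset s hs

theorem mem_below_iff {t : N} {x : V} :
    x ∈ below F T χ t ↔ x ∈ χ t ∨ ∃ c ∈ T.children t, x ∈ below F T χ c := by
  simp only [h.mem_below]
  constructor
  · rintro ⟨s, hs, hx⟩
    rcases RootedTree.desc_iff.1 hs with rfl | ⟨c, hc, hs⟩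
    · exact Or.inl hx
    · exact Or.inr ⟨c, hc, s, hs, hx⟩
  · rintro (hx | ⟨c, hc, s, hs, hx⟩)
    · exact ⟨t, RootedTree.Desc.refl _, hx⟩
    · exact ⟨s, (RootedTree.Desc.of_child hc).trans hs, hx⟩

theorem bag_subset_below (t : N) : χ t ⊆ below F T χ t :=
  fun _ hx => h.mem_below_iff.2 (Or.inl hx)

theorem below_root : below F T χ T.root = vars F := by
  classical
  apply Finset.Subset.antisymm (fun x hx => (Finset.mem_filter.1 hx).1)
  intro x hx
  obtain ⟨t, ht⟩ := h.isTreeDecomposition.vertex_covered x hx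
  exact h.mem_below.2 ⟨t, T.reachable t, ht⟩

theorem mem_bag_of_mem_below {t r : N} {x : V} (hr : ¬ T.Desc t r) (hx : x ∈ below F T χ t)
    (hxr : x ∈ χ r) : x ∈ χ t := by
  obtain ⟨s, hs, hxs⟩ := h.mem_below.1 hx
  exact (h.isTreeDecomposition.mem_bag_of_leaves hs hr hxs hxr).1

theorem mem_bag_of_mem_below_child {t c : N} {x : V} (hc : c ∈ T.children t)
    (hx : x ∈ below F T χ c) (hxt : x ∈ χ t) : x ∈ χ c :=
  h.mem_bag_of_mem_below (RootedTree.not_desc_child hc) hx hxt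

/-- A path between the subtrees of two siblings runs through their parent. -/
theorem mem_bag_of_mem_below_of_siblings {t c d : N} {x : V} (hc : c ∈ T.children t)
    (hd : d ∈ T.children t) (hcd : c ≠ d) (hx : x ∈ below F T χ c) (hx' : x ∈ below F T χ d) :
    x ∈ χ t := by
  obtain ⟨s, hs, hxs⟩ := h.mem_below.1 hx
  obtain ⟨r, hr, hxr⟩ := h.mem_below.1 hx'
  exact (h.isTreeDecomposition.mem_bag_of_leaves hs
    (RootedTree.not_desc_of_siblings hd hc hcd.symm hr) hxs hxr).2 t hc

theorem below_of_isLeaf {t : N} (ht : IsLeaf T t) : below F T χ t = ∅ := by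
  ext x
  rw [IsLeaf] at ht
  rw [h.mem_below_iff, h.bag_leaf t ht, ht]
  simp

/-- The variables of a clause are in a common bag. -/
theorem exists_clauseVars_subset_bag [Finite N] {c : Clause V} (hc : c ∈ F) :
    ∃ s, clauseVars c ⊆ χ s := by
  -- Descend from the root while all variables of `c` occur below the current node. If some `x`
  -- misses the bag of `t`, it occurs below a single child `d`, and so do the bags shared by `x`
  -- with the other variables; otherwise separation would put `x` into the bag of `t`.
  have key : ∀ t, clauseVars c ⊆ below F T χ t → ∃ s, clauseVars c ⊆ χ s := by
    intro t
    induction t using T.wellFounded_child.induction with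
    | _ t ih =>
      intro ht
      by_cases hsub : clauseVars c ⊆ χ t
      · exact ⟨t, hsub⟩
      obtain ⟨x, hx, hxt⟩ := Finset.not_subset.1 hsub
      obtain ⟨d, hd, hxd⟩ := (h.mem_below_iff.1 (ht hx)).resolve_left hxt
      refine ih d hd fun y hy => ?_
      have hcommon : ∃ s, x ∈ χ s ∧ y ∈ χ s := by
        by_cases hxy : x = y
        · subst hxy
          obtain ⟨s, -, hs⟩ := h.mem_below.1 hxd
          exact ⟨s, hs, hs⟩
        · exact h.isTreeDecomposition.edge_covered x y ⟨hxy, c, hc, hx, hy⟩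
      obtain ⟨s, hxs, hys⟩ := hcommon
      obtain ⟨r, hr, hxr⟩ := h.mem_below.1 hxd
      by_cases hs : T.Desc d s
      · exact h.mem_below.2 ⟨s, hs, hys⟩
      · exact absurd ((h.isTreeDecomposition.mem_bag_of_leaves hr hs hxr hxs).2 t hd) hxt
  apply key T.root
  rw [h.below_root]
  exact Finset.subset_biUnion_of_mem clauseVars hc

/-- Below a join or removal node there is a child whose bag contains the bag of the node. Leaf bags
are empty, so the descent can only stop at an introduce node. -/
theorem exists_isInt_subset_bag [Finite N] {s : N} {B : Finset V} (hB : B.Nonempty)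
    (hs : B ⊆ χ s) : ∃ t, IsInt T χ t ∧ B ⊆ χ t := by
  induction s using T.wellFounded_child.induction with
  | _ s ih =>
    rcases h.node_type s with hl | ⟨c, d, hcd, hc, -, -⟩ | hi | ⟨c, hc, hr⟩
    · rw [h.bag_leaf s hl] at hs
      exact absurd (Finset.subset_empty.1 hs) hB.ne_empty
    · exact ih c (by simp [hcd]) (hc ▸ hs)
    · exact ⟨s, hi, hs⟩
    · exact ih c (by simp [hc]) (hs.trans hr.1)

/-- If `F` is not the formula `{∅}`, every clause is checked at some introduce node. -/
theorem exists_isInt_clauseVars_subset [Finite N] (hF : F ≠ {∅}) {c : Clause V} (hc : c ∈ F) :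
    ∃ t, IsInt T χ t ∧ clauseVars c ⊆ χ t := by
  obtain ⟨s, hs⟩ := h.exists_clauseVars_subset_bag hc
  rcases (clauseVars c).eq_empty_or_nonempty with he | hne
  · have hc0 : c = ∅ := Finset.image_eq_empty.1 he
    -- The empty clause fits into every bag, so any introduce node checks it; a non-empty clause
    -- guarantees that one exists.
    have : ∃ d ∈ F, d ≠ ∅ := by
      by_contra! hcon
      exact hF (Finset.eq_singleton_iff_unique_mem.2 ⟨hc0 ▸ hc, hcon⟩)
    obtain ⟨d, hd, hd0⟩ := this
    obtain ⟨r, hr⟩ := h.exists_clauseVars_subset_bag hd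
    obtain ⟨t, ht, -⟩ := h.exists_isInt_subset_bag
      (Finset.image_nonempty.2 (Finset.nonempty_iff_ne_empty.2 hd0)) hr
    exact ⟨t, ht, by simp [he]⟩
  · exact h.exists_isInt_subset_bag hne hs

end IsNiceTreeDecomposition

/-! ### Models -/

theorem mem_models {J : Finset V} : J ∈ models F ↔ J ⊆ vars F ∧ Models J F := by
  simp [models]

theorem models_bagFormula_iff {J B : Finset V} : Models J (bagFormula F B) ↔
    ∀ c ∈ F, clauseVars c ⊆ B → ∃ l ∈ c, (l.1 ∈ J ↔ l.2 = true) := by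
  simp [Models, bagFormula]

theorem Models.bagFormula {J : Finset V} (h : Models J F) (B : Finset V) :
    Models J (bagFormula F B) :=
  models_bagFormula_iff.2 fun c hc _ => h c hc

/-- Whether a clause is satisfied depends only on its own variables. -/
theorem satisfied_congr {J K B : Finset V} {c : Clause V} (hJK : ∀ x ∈ B, x ∈ J ↔ x ∈ K)
    (hc : clauseVars c ⊆ B) (h : ∃ l ∈ c, (l.1 ∈ J ↔ l.2 = true)) :
    ∃ l ∈ c, (l.1 ∈ K ↔ l.2 = true) := by
  obtain ⟨l, hl, h⟩ := h
  exact ⟨l, hl, by rw [← hJK l.1 (hc (Finset.mem_image_of_mem _ hl)), h]⟩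

theorem Models.bagFormula_congr {J K B : Finset V} (hJK : ∀ x ∈ B, x ∈ J ↔ x ∈ K)
    (h : Models J (ProjCount.bagFormula F B)) : Models K (ProjCount.bagFormula F B) := by
  rw [models_bagFormula_iff] at h ⊢
  exact fun c hc hcB => satisfied_congr hJK hcB (h c hc hcB)

/-- Two models that agree on the bag of `t` can be combined: one is used below `t` and the other
elsewhere. -/
theorem IsNiceTreeDecomposition.glue_mem_models [Finite N] (h : IsNiceTreeDecomposition F T χ)
    {t : N} {J K : Finset V} (hJ : J ∈ models F) (hK : K ∈ models F)
    (hJK : J ∩ χ t = K ∩ χ t) :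
    J ∩ below F T χ t ∪ K \ below F T χ t ∈ models F := by
  rw [mem_models] at hJ hK ⊢
  refine ⟨Finset.union_subset (Finset.inter_subset_left.trans hJ.1)
    (Finset.sdiff_subset.trans hK.1), fun c hc => ?_⟩
  obtain ⟨s, hs⟩ := h.exists_clauseVars_subset_bag hc
  -- A clause in a bag below `t` is satisfied as by `J`. Any other clause is satisfied as by `K`,
  -- because its variables below `t` lie in the bag of `t`, where both models agree.
  by_cases hts : T.Desc t s
  · refine satisfied_congr (fun x hx => ?_) hs (hJ.2 c hc)
    have : x ∈ below F T χ t := h.mem_below.2 ⟨s, hts, hx⟩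
    simp [this]
  · refine satisfied_congr (fun x hx => ?_) hs (hK.2 c hc)
    by_cases hxt : x ∈ below F T χ t
    · have hxB := h.mem_bag_of_mem_below hts hxt hx
      have hx' := Finset.ext_iff.1 hJK x
      simp only [Finset.mem_inter, hxB, and_true] at hx'
      simp [hxt, hx']
    · simp [hxt]

end Decompositions


/-! ### The first pass and purging -/

section FirstPass

variable {V : Type u} [DecidableEq V] {N : Type v} {F : Formula V} {T : RootedTree N}
  {χ : N → Finset V}

omit [DecidableEq V] in
theorem Removes.not_introduces {t c : N} (h : Removes χ t c) : ¬ Introduces χ t c := by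
  intro h'
  have h1 := h.2
  have h2 := h'.2
  omega

/-! ### SAT-rows and origins for each node type -/

theorem mem_sat_of_isLeaf {t : N} (ht : IsLeaf T t) {u : Row V} :
    u ∈ sat F T χ t [] ↔ u = ∅ := by
  rw [IsLeaf] at ht
  simp [sat, ht]

theorem mem_sat_of_introduces {t c : N} (hc : T.children t = [c]) (hi : Introduces χ t c)
    {τ : Table V} {u : Row V} : u ∈ sat F T χ t [τ] ↔
      ∃ J ∈ τ, (u = J ∨ u = J ∪ χ t \ χ c) ∧ Models u (bagFormula F (χ t)) := by
  simp [sat, hc, hi]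

theorem mem_sat_of_removes {t c : N} (hc : T.children t = [c]) (hr : Removes χ t c)
    {τ : Table V} {u : Row V} : u ∈ sat F T χ t [τ] ↔ ∃ J ∈ τ, J \ (χ c \ χ t) = u := by
  simp [sat, hc, hr, hr.not_introduces]

theorem mem_sat_of_join {t c d : N} (hc : T.children t = [c, d]) {τ τ' : Table V} {u : Row V} :
    u ∈ sat F T χ t [τ, τ'] ↔ u ∈ τ ∧ u ∈ τ' := by
  simp [sat, hc]

theorem mem_orig_one {t c : N} (hc : T.children t = [c]) {τ : N → Table V} {u : Row V}
    {v : List (Row V)} :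
    v ∈ orig F T χ τ t u ↔ ∃ r ∈ τ c, v = [r] ∧ u ∈ sat F T χ t [{r}] := by
  simp only [orig, hc, List.map_cons, List.map_nil, seqProd, Finset.mem_filter, Finset.mem_image,
    Finset.mem_product, Finset.mem_singleton, Prod.exists]
  constructor
  · rintro ⟨⟨r, l, ⟨hr, rfl⟩, rfl⟩, hu⟩
    exact ⟨r, hr, rfl, hu⟩
  · rintro ⟨r, hr, rfl, hu⟩
    exact ⟨⟨r, [], ⟨hr, rfl⟩, rfl⟩, hu⟩

/-- SAT intersects two singletons at a join, so both components of an origin are the row itself. -/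
theorem mem_orig_two {t c d : N} (hc : T.children t = [c, d]) {τ : N → Table V} {u : Row V}
    {v : List (Row V)} :
    v ∈ orig F T χ τ t u ↔ v = [u, u] ∧ u ∈ τ c ∧ u ∈ τ d := by
  simp only [orig, hc, List.map_cons, List.map_nil, seqProd, Finset.mem_filter, Finset.mem_image,
    Finset.mem_product, Finset.mem_singleton, Prod.exists]
  constructor
  · rintro ⟨⟨r, l, ⟨hr, s, l', ⟨hs, rfl⟩, rfl⟩, rfl⟩, hu⟩
    simp only [List.map_cons, List.map_nil, mem_sat_of_join hc, Finset.mem_singleton] at hu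
    obtain ⟨rfl, rfl⟩ := hu
    exact ⟨rfl, hr, hs⟩
  · rintro ⟨rfl, hr, hs⟩
    refine ⟨⟨u, [u], ⟨hr, u, [], ⟨hs, rfl⟩, rfl⟩, rfl⟩, ?_⟩
    simp [mem_sat_of_join hc]

/-- The restrictions of a model to the bags of the children of `t` yield its restriction to the bag
of `t`. -/
theorem inter_bag_mem_sat_of_introduces {t c : N} (hc : T.children t = [c])
    (hi : Introduces χ t c) {J : Finset V} (hJ : Models J F) :
    J ∩ χ t ∈ sat F T χ t [{J ∩ χ c}] := by
  rw [mem_sat_of_introduces hc hi]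
  refine ⟨J ∩ χ c, Finset.mem_singleton_self _, ?_,
    (hJ.bagFormula _).bagFormula_congr fun x hx => by simp [hx]⟩
  have hcard : (χ t \ χ c).card = 1 := by
    rw [Finset.card_sdiff_of_subset hi.1, hi.2]
    omega
  obtain ⟨a, ha⟩ := Finset.card_eq_one.1 hcard
  have hmem : ∀ x, x ∈ χ t ↔ x ∈ χ c ∨ x = a := by
    intro x
    have h1 := Finset.ext_iff.1 ha x
    have h2 := @hi.1 x
    simp only [Finset.mem_sdiff, Finset.mem_singleton] at h1
    tauto
  rw [ha]
  by_cases haJ : a ∈ J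
  · right
    ext x
    simp only [Finset.mem_inter, Finset.mem_union, Finset.mem_singleton, hmem]
    constructor
    · tauto
    · rintro (h | rfl) <;> tauto
  · left
    ext x
    simp only [Finset.mem_inter, hmem]
    constructor
    · rintro ⟨h1, h2 | rfl⟩ <;> tauto
    · tauto

/-- Deleting the removed variable amounts to restricting to the smaller bag. -/
theorem sdiff_sdiff_bag {t c : N} {r : Row V} (hrc : r ⊆ χ c) :
    r \ (χ c \ χ t) = r ∩ χ t := by
  ext x
  have := @hrc x
  simp only [Finset.mem_sdiff, Finset.mem_inter]
  tauto

theorem inter_bag_inter_bag {t c : N} (h : χ t ⊆ χ c) (J : Finset V) :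
    J ∩ χ c ∩ χ t = J ∩ χ t := by
  rw [Finset.inter_assoc, Finset.inter_eq_right.2 h]

theorem inter_bag_mem_sat_of_removes {t c : N} (hc : T.children t = [c])
    (hr : Removes χ t c) (J : Finset V) : J ∩ χ t ∈ sat F T χ t [{J ∩ χ c}] := by
  rw [mem_sat_of_removes hc hr]
  exact ⟨J ∩ χ c, Finset.mem_singleton_self _, by
    rw [sdiff_sdiff_bag Finset.inter_subset_right, inter_bag_inter_bag hr.1]⟩

/-- A row at an introduce node restricts to its origin. -/
theorem inter_bag_of_mem_sat_of_introduces {t c : N} (hc : T.children t = [c])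
    (hi : Introduces χ t c) {u r : Row V} (hr : r ⊆ χ c) (hu : u ∈ sat F T χ t [{r}]) :
    u ∩ χ c = r ∧ u ⊆ χ t ∧ Models u (bagFormula F (χ t)) := by
  obtain ⟨J, hJ, huJ, hm⟩ := (mem_sat_of_introduces hc hi).1 hu
  obtain rfl := Finset.mem_singleton.1 hJ
  refine ⟨?_, ?_, hm⟩
  · rcases huJ with rfl | rfl
    · exact Finset.inter_eq_left.2 hr
    · ext x
      have := @hr x
      simp only [Finset.mem_inter, Finset.mem_union, Finset.mem_sdiff]
      tauto
  · rcases huJ with rfl | rfl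
    · exact hr.trans hi.1
    · exact Finset.union_subset (hr.trans hi.1) Finset.sdiff_subset

theorem eq_inter_bag_of_mem_sat_of_removes {t c : N} (hc : T.children t = [c])
    (hr : Removes χ t c) {u r : Row V} (hrc : r ⊆ χ c) (hu : u ∈ sat F T χ t [{r}]) :
    u = r ∩ χ t := by
  obtain ⟨J, hJ, huJ⟩ := (mem_sat_of_removes hc hr).1 hu
  obtain rfl := Finset.mem_singleton.1 hJ
  rw [← huJ, sdiff_sdiff_bag hrc]

section Finite

variable [Finite N]

/-! ### Recursive description of the SAT-tables and the extensions -/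

theorem mem_dpSat_of_isLeaf {t : N} (ht : IsLeaf T t) {u : Row V} :
    u ∈ dpSat F T χ t ↔ u = ∅ := by
  rw [dpSat, T.dp_eq, show T.children t = [] from ht, List.map_nil, mem_sat_of_isLeaf ht]

theorem dpSat_one {t c : N} (hc : T.children t = [c]) :
    dpSat F T χ t = sat F T χ t [dpSat F T χ c] := by
  rw [dpSat, T.dp_eq, hc, List.map_cons, List.map_nil]

theorem dpSat_two {t c d : N} (hc : T.children t = [c, d]) :
    dpSat F T χ t = dpSat F T χ c ∩ dpSat F T χ d := by
  rw [dpSat, T.dp_eq, hc, List.map_cons, List.map_cons, List.map_nil]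
  ext u
  rw [mem_sat_of_join hc, Finset.mem_inter]

theorem mem_dpSat_of_introduces {t c : N} (hc : T.children t = [c]) (hi : Introduces χ t c)
    {r u : Row V} (hr : r ∈ dpSat F T χ c) (hu : u ∈ sat F T χ t [{r}]) : u ∈ dpSat F T χ t := by
  rw [dpSat_one hc, mem_sat_of_introduces hc hi]
  rw [mem_sat_of_introduces hc hi] at hu
  simp only [Finset.mem_singleton, exists_eq_left] at hu
  exact ⟨r, hr, hu⟩

theorem mem_dpSat_of_removes {t c : N} (hc : T.children t = [c]) (hi : Removes χ t c)
    {r u : Row V} (hr : r ∈ dpSat F T χ c) (hu : u ∈ sat F T χ t [{r}]) : u ∈ dpSat F T χ t := by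
  rw [dpSat_one hc, mem_sat_of_removes hc hi]
  rw [mem_sat_of_removes hc hi] at hu
  simp only [Finset.mem_singleton, exists_eq_left] at hu
  exact ⟨r, hr, hu⟩

theorem ext_of_isLeaf {t : N} (ht : IsLeaf T t) (u : Row V) : ext F T χ t u = {{(t, u)}} := by
  rw [ext, T.dp_eq]
  simp [show T.children t = [] from ht]

theorem mem_ext_one {t c : N} (hc : T.children t = [c]) {u : Row V} {X : Set (N × Row V)} :
    X ∈ ext F T χ t u ↔ ∃ r ∈ dpSat F T χ c, u ∈ sat F T χ t [{r}] ∧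
      ∃ Y ∈ ext F T χ c r, X = {(t, u)} ∪ Y := by
  rw [ext, T.dp_eq]
  simp only [hc, List.isEmpty_cons, Bool.false_eq_true, if_false, List.map_cons, List.map_nil,
    Set.mem_ofPred_eq, mem_orig_one hc]
  constructor
  · rintro ⟨v, ⟨r, hr, rfl, hu⟩, Xs, hXs, rfl⟩
    simp only [List.zipWith_cons_cons, List.zipWith_nil_left] at hXs
    rcases hXs with _ | ⟨hY, hXs⟩
    cases hXs
    exact ⟨r, hr, hu, _, hY, by simp⟩
  · rintro ⟨r, hr, hu, Y, hY, rfl⟩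
    exact ⟨[r], ⟨r, hr, rfl, hu⟩, [Y], List.Forall₂.cons hY List.Forall₂.nil, by simp⟩

theorem mem_ext_two {t c d : N} (hc : T.children t = [c, d]) {u : Row V} {X : Set (N × Row V)} :
    X ∈ ext F T χ t u ↔ u ∈ dpSat F T χ c ∧ u ∈ dpSat F T χ d ∧
      ∃ Y ∈ ext F T χ c u, ∃ Z ∈ ext F T χ d u, X = {(t, u)} ∪ (Y ∪ Z) := by
  rw [ext, T.dp_eq]
  simp only [hc, List.isEmpty_cons, Bool.false_eq_true, if_false, List.map_cons, List.map_nil,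
    Set.mem_ofPred_eq, mem_orig_two hc]
  constructor
  · rintro ⟨v, ⟨rfl, h1, h2⟩, Xs, hXs, rfl⟩
    simp only [List.zipWith_cons_cons, List.zipWith_nil_left] at hXs
    rcases hXs with _ | ⟨hY, _ | ⟨hZ, hXs⟩⟩
    cases hXs
    exact ⟨h1, h2, _, hY, _, hZ, by simp⟩
  · rintro ⟨h1, h2, Y, hY, Z, hZ, rfl⟩
    exact ⟨[u, u], ⟨rfl, h1, h2⟩, [Y, Z],
      List.Forall₂.cons hY (List.Forall₂.cons hZ List.Forall₂.nil), by simp⟩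

namespace IsNiceTreeDecomposition

variable (h : IsNiceTreeDecomposition F T χ)
include h

/-- The restrictions of a model to the bags below `t` form an extension below `t`. -/
theorem restrictions_mem_ext {J : Finset V} (hJ : Models J F) (t : N) :
    J ∩ χ t ∈ dpSat F T χ t ∧
      {p : N × Row V | T.Desc t p.1 ∧ p.2 = J ∩ χ p.1} ∈ ext F T χ t (J ∩ χ t) := by
  have one : ∀ t c, T.children t = [c] →
      ({p : N × Row V | T.Desc t p.1 ∧ p.2 = J ∩ χ p.1} =
        {(t, J ∩ χ t)} ∪ {p : N × Row V | T.Desc c p.1 ∧ p.2 = J ∩ χ p.1}) := by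
    intro t c hc
    ext ⟨s, w⟩
    simp only [Set.mem_ofPred_eq, Set.singleton_union, Set.mem_insert_iff, Prod.mk.injEq]
    rw [RootedTree.desc_iff, hc]
    simp only [List.mem_singleton, exists_eq_left]
    constructor
    · rintro ⟨rfl | h1, h2⟩ <;> tauto
    · rintro (⟨rfl, h2⟩ | h2) <;> tauto
  induction t using T.wellFounded_child.induction with
  | _ t ih =>
    rcases h.node_type t with hl | ⟨c, d, hc, hχc, hχd, -⟩ | ⟨c, hc, hi⟩ | ⟨c, hc, hr⟩
    · rw [mem_dpSat_of_isLeaf hl, ext_of_isLeaf hl, h.bag_leaf t hl]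
      refine ⟨by simp, Set.mem_singleton_iff.2 ?_⟩
      ext ⟨s, w⟩
      simp only [Set.mem_ofPred_eq, Set.mem_singleton_iff, Prod.mk.injEq]
      rw [RootedTree.desc_iff, show T.children t = [] from hl]
      simp only [List.not_mem_nil, false_and, exists_false, or_false, Finset.inter_empty]
      constructor
      · rintro ⟨rfl, h2⟩
        simp [h2, h.bag_leaf s hl]
      · rintro ⟨rfl, h2⟩
        simp [h2, h.bag_leaf s hl]
    · obtain ⟨h1, h2⟩ := ih c (by simp [hc])
      obtain ⟨h3, h4⟩ := ih d (by simp [hc])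
      rw [← hχc] at h1 h2
      rw [← hχd] at h3 h4
      rw [dpSat_two hc, Finset.mem_inter, mem_ext_two hc]
      refine ⟨⟨h1, h3⟩, h1, h3, _, h2, _, h4, ?_⟩
      ext ⟨s, w⟩
      simp only [Set.mem_ofPred_eq, Set.singleton_union, Set.mem_insert_iff, Prod.mk.injEq,
        Set.mem_union]
      rw [RootedTree.desc_iff, hc]
      simp only [List.mem_cons, List.not_mem_nil, or_false, exists_eq_or_imp, exists_eq_left]
      constructor
      · rintro ⟨rfl | h1, h2⟩ <;> tauto
      · rintro (⟨rfl, h2⟩ | h2) <;> tauto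
    · obtain ⟨h1, h2⟩ := ih c (by simp [hc])
      have hs := inter_bag_mem_sat_of_introduces hc hi hJ
      exact ⟨mem_dpSat_of_introduces hc hi h1 hs,
        (mem_ext_one hc).2 ⟨_, h1, hs, _, h2, one t c hc⟩⟩
    · obtain ⟨h1, h2⟩ := ih c (by simp [hc])
      have hs := inter_bag_mem_sat_of_removes (F := F) hc hr J
      exact ⟨mem_dpSat_of_removes hc hr h1 hs,
        (mem_ext_one hc).2 ⟨_, h1, hs, _, h2, one t c hc⟩⟩

/-- The rows of an extension below `t` are the restrictions of an assignment that satisfies the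
clauses checked below `t`. -/
theorem exists_of_mem_ext (t : N) {u : Row V} (hu : u ∈ dpSat F T χ t) {X : Set (N × Row V)}
    (hX : X ∈ ext F T χ t u) :
    ∃ J ⊆ below F T χ t, u = J ∩ χ t ∧ (∀ p ∈ X, T.Desc t p.1 ∧ p.2 = J ∩ χ p.1) ∧
      ∀ s, T.Desc t s → IsInt T χ s → Models J (bagFormula F (χ s)) := by
  induction t using T.wellFounded_child.induction generalizing u X with
  | _ t ih =>
    rcases h.node_type t with hl | ⟨c, d, hc, hχc, hχd, -⟩ | ⟨c, hc, hi⟩ | ⟨c, hc, hr⟩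
    · rw [mem_dpSat_of_isLeaf hl] at hu
      rw [ext_of_isLeaf hl, Set.mem_singleton_iff] at hX
      subst hu hX
      refine ⟨∅, by simp, by simp, ?_, ?_⟩
      · rintro p rfl
        exact ⟨RootedTree.Desc.refl _, by simp⟩
      · rintro s hs ⟨c, hc, -⟩
        rw [RootedTree.desc_iff, show T.children t = [] from hl] at hs
        simp only [List.not_mem_nil, false_and, exists_false, or_false] at hs
        subst hs
        rw [show T.children s = [] from hl] at hc
        simp at hc
    · obtain ⟨h1, h2, Y, hY, Z, hZ, rfl⟩ := (mem_ext_two hc).1 hX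
      have hct : c ∈ T.children t := by simp [hc]
      have hdt : d ∈ T.children t := by simp [hc]
      have hcd : c ≠ d := by
        have := T.nodup_children t
        rw [hc] at this
        simpa using this
      obtain ⟨J, hJ, huJ, hJY, hJm⟩ := ih c hct h1 hY
      obtain ⟨K, hK, huK, hKZ, hKm⟩ := ih d hdt h2 hZ
      rw [← hχc] at huJ
      rw [← hχd] at huK
      have huJ' := Finset.ext_iff.1 huJ
      have huK' := Finset.ext_iff.1 huK
      simp only [Finset.mem_inter] at huJ' huK'
      -- A variable of `K` in a bag below `c` occurs below both siblings, hence in the bag of `t`,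
      -- where `J` and `K` both restrict to `u`. So adding `K` changes nothing on that side.
      have hJs : ∀ s, T.Desc c s → ∀ x ∈ χ s, x ∈ J ↔ x ∈ J ∪ K := by
        intro s hs x hx
        rw [Finset.mem_union]
        refine ⟨Or.inl, fun hx' => hx'.elim id fun hxK => ?_⟩
        have := h.mem_bag_of_mem_below_of_siblings hct hdt hcd (h.mem_below.2 ⟨s, hs, hx⟩) (hK hxK)
        exact ((huJ' x).1 ((huK' x).2 ⟨hxK, this⟩)).1
      have hKs : ∀ s, T.Desc d s → ∀ x ∈ χ s, x ∈ K ↔ x ∈ J ∪ K := by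
        intro s hs x hx
        rw [Finset.mem_union]
        refine ⟨Or.inr, fun hx' => hx'.elim (fun hxJ => ?_) id⟩
        have := h.mem_bag_of_mem_below_of_siblings hct hdt hcd (hJ hxJ) (h.mem_below.2 ⟨s, hs, hx⟩)
        exact ((huK' x).1 ((huJ' x).2 ⟨hxJ, this⟩)).1
      have hinter : ∀ {s : N} {L M : Finset V}, (∀ x ∈ χ s, x ∈ L ↔ x ∈ M) →
          L ∩ χ s = M ∩ χ s := by
        intro s L M hLM
        ext x
        simp only [Finset.mem_inter, and_congr_left_iff]
        exact hLM x
      have hut : u = (J ∪ K) ∩ χ t := by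
        rw [Finset.union_inter_distrib_right, ← huJ, ← huK, Finset.union_self]
      refine ⟨J ∪ K, ?_, hut, ?_, ?_⟩
      · intro x hx
        rw [h.mem_below_iff]
        rcases Finset.mem_union.1 hx with hx | hx
        · exact Or.inr ⟨c, hct, hJ hx⟩
        · exact Or.inr ⟨d, hdt, hK hx⟩
      · rintro p (rfl | hp | hp)
        · exact ⟨RootedTree.Desc.refl _, hut⟩
        · obtain ⟨h3, h4⟩ := hJY p hp
          exact ⟨(RootedTree.Desc.of_child hct).trans h3, h4.trans (hinter (hJs _ h3))⟩
        · obtain ⟨h3, h4⟩ := hKZ p hp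
          exact ⟨(RootedTree.Desc.of_child hdt).trans h3, h4.trans (hinter (hKs _ h3))⟩
      · intro s hs hsi
        rcases RootedTree.desc_iff.1 hs with rfl | ⟨e, he, hs⟩
        · obtain ⟨e, he, -⟩ := hsi
          rw [hc] at he
          simp at he
        · rw [hc] at he
          simp only [List.mem_cons, List.not_mem_nil, or_false] at he
          rcases he with rfl | rfl
          · exact (hJm s hs hsi).bagFormula_congr (hJs s hs)
          · exact (hKm s hs hsi).bagFormula_congr (hKs s hs)
    · obtain ⟨r, hr, hur, Y, hY, rfl⟩ := (mem_ext_one hc).1 hX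
      have hct : c ∈ T.children t := by simp [hc]
      obtain ⟨J, hJ, hrJ, hJY, hJm⟩ := ih c hct hr hY
      obtain ⟨h1, h2, h3⟩ := inter_bag_of_mem_sat_of_introduces hc hi
        (hrJ ▸ Finset.inter_subset_right) hur
      rw [hrJ] at h1
      have h1' := Finset.ext_iff.1 h1
      simp only [Finset.mem_inter] at h1'
      have hnew : ∀ x, x ∈ below F T χ c → x ∈ χ t → x ∈ χ c :=
        fun x => h.mem_bag_of_mem_below_child hct
      -- `J` and `u` agree on the bag of `c`, and the introduced variable does not occur below `c`,
      -- so the two can be merged.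
      have hut : u = (J ∪ u) ∩ χ t := by
        ext x
        simp only [Finset.mem_inter, Finset.mem_union]
        refine ⟨fun hx => ⟨Or.inr hx, h2 hx⟩, fun hx => hx.1.elim (fun hxJ => ?_) id⟩
        exact ((h1' x).2 ⟨hxJ, hnew x (hJ hxJ) hx.2⟩).1
      have hJs : ∀ s, T.Desc c s → ∀ x ∈ χ s, x ∈ J ↔ x ∈ J ∪ u := by
        intro s hs x hx
        rw [Finset.mem_union]
        refine ⟨Or.inl, fun hx' => hx'.elim id fun hxu => ?_⟩
        exact ((h1' x).1 ⟨hxu, hnew x (h.mem_below.2 ⟨s, hs, hx⟩) (h2 hxu)⟩).1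
      refine ⟨J ∪ u, ?_, hut, ?_, ?_⟩
      · intro x hx
        rw [h.mem_below_iff]
        rcases Finset.mem_union.1 hx with hx | hx
        · exact Or.inr ⟨c, hct, hJ hx⟩
        · exact Or.inl (h2 hx)
      · rintro p (rfl | hp)
        · exact ⟨RootedTree.Desc.refl _, hut⟩
        · obtain ⟨h4, h5⟩ := hJY p hp
          refine ⟨(RootedTree.Desc.of_child hct).trans h4, h5.trans ?_⟩
          ext x
          simp only [Finset.mem_inter, and_congr_left_iff]
          exact hJs _ h4 x
      · intro s hs hsi
        rcases RootedTree.desc_iff.1 hs with rfl | ⟨e, he, hs⟩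
        · refine h3.bagFormula_congr fun x hx => ?_
          have := Finset.ext_iff.1 hut x
          simp only [Finset.mem_inter, hx, and_true] at this
          exact this
        · rw [hc] at he
          obtain rfl := List.mem_singleton.1 he
          exact (hJm s hs hsi).bagFormula_congr (hJs s hs)
    · obtain ⟨r, hr', hur, Y, hY, rfl⟩ := (mem_ext_one hc).1 hX
      have hct : c ∈ T.children t := by simp [hc]
      obtain ⟨J, hJ, hrJ, hJY, hJm⟩ := ih c hct hr' hY
      have hut := eq_inter_bag_of_mem_sat_of_removes hc hr
        (hrJ ▸ Finset.inter_subset_right) hur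
      rw [hrJ, inter_bag_inter_bag hr.1] at hut
      refine ⟨J, fun x hx => h.mem_below_iff.2 (Or.inr ⟨c, hct, hJ hx⟩), hut, ?_, ?_⟩
      · rintro p (rfl | hp)
        · exact ⟨RootedTree.Desc.refl _, hut⟩
        · obtain ⟨h3, h4⟩ := hJY p hp
          exact ⟨(RootedTree.Desc.of_child hct).trans h3, h4⟩
      · intro s hs hsi
        rcases RootedTree.desc_iff.1 hs with rfl | ⟨e, he, hs⟩
        · obtain ⟨e, he, hi⟩ := hsi
          rw [hc] at he
          obtain rfl : c = e := by simpa using he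
          exact absurd hi hr.not_introduces
        · rw [hc] at he
          obtain rfl := List.mem_singleton.1 he
          exact hJm s hs hsi

/-- The rows of the purged tables are the restrictions of the models. -/
theorem mem_purgedSat (hF : F ≠ {∅}) {t : N} {u : Row V} :
    u ∈ purgedSat F T χ t ↔ ∃ J ∈ models F, J ∩ χ t = u := by
  classical
  simp only [purgedSat, satExt, rootExts, Finset.mem_filter, Set.mem_iUnion, Set.mem_ofPred_eq,
    exists_prop]
  constructor
  · rintro ⟨-, X, ⟨w, -, -, Y, ⟨r, hr, hY⟩, hXY⟩, hu⟩
    -- Only the surrounding root extension `Y` matters: one assignment induces all of its rows,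
    -- among them `u`.
    obtain ⟨J, hJ, -, hJY, hJm⟩ := h.exists_of_mem_ext T.root hr hY
    rw [h.below_root] at hJ
    refine ⟨J, mem_models.2 ⟨hJ, fun c hc => ?_⟩, (hJY _ (hXY hu)).2.symm⟩
    obtain ⟨s, hs, hcs⟩ := h.exists_isInt_clauseVars_subset hF hc
    exact models_bagFormula_iff.1 (hJm s (T.reachable s) hs) c hc hcs
  · rintro ⟨J, hJ, rfl⟩
    obtain ⟨h1, h2⟩ := h.restrictions_mem_ext (mem_models.1 hJ).2 t
    obtain ⟨h3, h4⟩ := h.restrictions_mem_ext (mem_models.1 hJ).2 T.root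
    exact ⟨h1, _, ⟨_, h1, h2, _, ⟨_, h3, h4⟩, fun p hp => ⟨T.reachable _, hp.2⟩⟩,
      RootedTree.Desc.refl t, rfl⟩

end IsNiceTreeDecomposition

end Finite

end FirstPass


/-! ### Inclusion-exclusion -/

section InclusionExclusion

variable {ι κ α β : Type*} [DecidableEq α] [DecidableEq β]

/-- The intersection of a family of finite sets over a non-empty finite index set. -/
def inter (s : Finset ι) (A : ι → Finset α) [DecidableEq ι] : Finset α :=
  (s.biUnion A).filter fun x => ∀ i ∈ s, x ∈ A i

variable [DecidableEq ι] [DecidableEq κ]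

theorem mem_inter {s : Finset ι} (hs : s.Nonempty) {A : ι → Finset α} {x : α} :
    x ∈ inter s A ↔ ∀ i ∈ s, x ∈ A i := by
  obtain ⟨i, hi⟩ := hs
  rw [inter, Finset.mem_filter, Finset.mem_biUnion]
  exact ⟨fun h => h.2, fun h => ⟨⟨i, hi, h i hi⟩, h⟩⟩

/-- PROJ looks up the counters of `O_(i)`, an image of `O`; this moves the intersection back to the
index set `O` over which `pcnt` sums. -/
theorem inter_image {s : Finset κ} (hs : s.Nonempty) (g : κ → ι) (A : ι → Finset α) :
    inter (s.image g) A = inter s fun i => A (g i) := by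
  ext x
  rw [mem_inter hs, mem_inter (hs.image g)]
  simp

theorem inter_product {s : Finset ι} (hs : s.Nonempty) (A : ι → Finset α) (B : ι → Finset β) :
    (inter s fun i => A i ×ˢ B i) = inter s A ×ˢ inter s B := by
  ext ⟨x, y⟩
  simp only [Finset.mem_product, mem_inter hs]
  exact ⟨fun h => ⟨fun i hi => (h i hi).1, fun i hi => (h i hi).2⟩,
    fun h i hi => ⟨h.1 i hi, h.2 i hi⟩⟩

theorem card_biUnion_eq_sum_inter (s : Finset ι) (A : ι → Finset α) :
    ((s.biUnion A).card : ℤ) =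
      ∑ O ∈ s.powerset.filter (fun O => O.Nonempty), (-1) ^ (O.card - 1) * ((inter O A).card : ℤ) := by
  rw [Finset.inclusion_exclusion_card_biUnion,
    ← Finset.sum_coe_sort (s.powerset.filter fun O => O.Nonempty)]
  refine Finset.sum_congr rfl fun O _ => ?_
  have hO := (Finset.mem_filter.1 O.2).2
  have hinf : O.1.inf' hO A = inter O.1 A := by
    ext x
    rw [mem_inter hO, ← Finset.singleton_subset_iff, Finset.le_inf'_iff]
    simp
  rw [← hinf]
  congr 1
  -- As `O` is non-empty, the truncated `O.card - 1` has the same parity as `O.card + 1`.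
  obtain ⟨k, hk⟩ := Nat.exists_eq_succ_of_ne_zero hO.card_pos.ne'
  rw [hk, Nat.succ_sub_one, pow_succ, pow_succ]
  ring

/-- The intersection of all sets is obtained from their union and the intersections of fewer sets. -/
theorem natAbs_card_biUnion_add_sum {s : Finset ι} (hs : s.Nonempty) (A : ι → Finset α) :
    (((s.biUnion A).card : ℤ) + ∑ O ∈ s.ssubsets.filter (fun O => O.Nonempty),
      (-1) ^ O.card * ((inter O A).card : ℤ)).natAbs = (inter s A).card := by
  have hset : s.powerset.filter (fun O => O.Nonempty) =
      insert s (s.ssubsets.filter fun O => O.Nonempty) := by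
    ext O
    simp only [Finset.mem_filter, Finset.mem_powerset, Finset.mem_insert, Finset.mem_ssubsets,
      Finset.ssubset_iff_subset_ne]
    constructor
    · rintro ⟨h1, h2⟩
      by_cases h3 : O = s <;> tauto
    · rintro (rfl | h) <;> tauto
  -- The terms of the proper subsets cancel against the added sum. What remains is the term of `s`,
  -- whose sign is dropped by `natAbs`.
  rw [card_biUnion_eq_sum_inter, hset, Finset.sum_insert (by simp), add_assoc,
    ← Finset.sum_add_distrib, Finset.sum_eq_zero, add_zero, Int.natAbs_mul, Int.natAbs_pow]
  · simp
  · intro O hO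
    obtain ⟨k, hk⟩ := Nat.exists_eq_succ_of_ne_zero (Finset.mem_filter.1 hO).2.card_pos.ne'
    rw [hk, Nat.succ_sub_one, pow_succ]
    ring

end InclusionExclusion

/-! ### The second pass -/

section SecondPass

variable {V : Type u} [DecidableEq V] {N : Type v} {F : Formula V} {P : Finset V}
  {T : RootedTree N} {χ : N → Finset V} {τ : N → Table V}

theorem mem_subBuckets {τ σ : Table V} : σ ∈ subBuckets P τ ↔
    σ.Nonempty ∧ σ ⊆ τ ∧ ∀ u ∈ σ, ∀ w ∈ σ, u ∩ P = w ∩ P := by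
  simp only [subBuckets, buckets, Finset.mem_filter, Finset.mem_powerset, Finset.mem_image,
    exists_exists_and_eq_and]
  constructor
  · rintro ⟨h1, h2, a, -, ha⟩
    exact ⟨h2, h1, fun u hu w hw =>
      (Finset.mem_filter.1 (ha hu)).2.trans (Finset.mem_filter.1 (ha hw)).2.symm⟩
  · rintro ⟨⟨a, ha⟩, h2, h3⟩
    exact ⟨h2, ⟨a, ha⟩, a, h2 ha, fun u hu => Finset.mem_filter.2 ⟨h2 hu, h3 u hu a ha⟩⟩

/-- A PROJ-table is the graph of a function, so the sum has at most one term. -/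
theorem sipmc_image (S : Finset (Table V)) (f : Table V → ℕ) (σ : Table V) :
    sipmc (S.image fun ρ => (ρ, f ρ)) σ = if σ ∈ S then f σ else 0 := by
  have : (S.image fun ρ => (ρ, f ρ)).filter (fun p => p.1 = σ) =
      if σ ∈ S then {(σ, f σ)} else ∅ := by
    ext ⟨ρ, n⟩
    simp only [Finset.mem_filter, Finset.mem_image, Prod.mk.injEq]
    split_ifs with h
    · rw [Finset.mem_singleton, Prod.mk.injEq]
      constructor
      · rintro ⟨⟨_, _, rfl, rfl⟩, rfl⟩
        exact ⟨rfl, rfl⟩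
      · rintro ⟨rfl, rfl⟩
        exact ⟨⟨_, h, rfl, rfl⟩, rfl⟩
    · simp only [Finset.notMem_empty, iff_false]
      rintro ⟨⟨_, h', rfl, rfl⟩, rfl⟩
      exact h h'
  rw [sipmc, this]
  split_ifs <;> simp

/-- The recursion for `ipmc` is the identity `natAbs_card_biUnion_add_sum`. Since it visits all
non-empty subsets of `σ`, the value of `pcnt` is needed for each of them. -/
theorem ipmc_eq_card_inter {α : Type*} [DecidableEq α] {t : N} (ht : ¬ IsLeaf T t)
    {Tab : List (ProjTable V)} {A : Row V → Finset α} {σ : Table V} (hσ : σ.Nonempty)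
    (hpcnt : ∀ ρ ⊆ σ, ρ.Nonempty → pcnt F T χ τ t ρ Tab = (ρ.biUnion A).card) :
    ipmc F T χ τ t σ Tab = (inter σ A).card := by
  induction σ using Finset.strongInduction with
  | H σ ih =>
    rw [ipmc_eq, if_neg (by simpa [List.isEmpty_iff, IsLeaf] using ht), ← natAbs_card_biUnion_add_sum hσ A,
      hpcnt σ Finset.Subset.rfl hσ]
    congr 2
    refine Finset.sum_congr rfl fun ρ hρ => ?_
    obtain ⟨h1, h2⟩ := Finset.mem_filter.1 hρ
    have h3 := Finset.mem_ssubsets.1 h1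
    rw [ih ρ h3 h2 fun ξ hξ => hpcnt ξ (hξ.trans h3.subset)]

theorem pcnt_eq_card_biUnion {α : Type*} [DecidableEq α] {t : N} {Tab : List (ProjTable V)}
    {B : List (Row V) → Finset α} {σ : Table V}
    (hB : ∀ O ⊆ origs F T χ τ t σ, O.Nonempty → sipmcSeq Tab O = (inter O B).card) :
    pcnt F T χ τ t σ Tab = ((origs F T χ τ t σ).biUnion B).card := by
  rw [card_biUnion_eq_sum_inter, pcnt]
  refine Finset.sum_congr rfl fun O hO => ?_
  obtain ⟨h1, h2⟩ := Finset.mem_filter.1 hO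
  rw [hB O (Finset.mem_powerset.1 h1) h2]

theorem sipmcSeq_one (ι : ProjTable V) (O : Finset (List (Row V))) :
    sipmcSeq [ι] O = sipmc ι (O.image fun s => s.getD 0 ∅) := by
  simp [sipmcSeq]

theorem sipmcSeq_two (ι κ : ProjTable V) (O : Finset (List (Row V))) :
    sipmcSeq [ι, κ] O =
      sipmc ι (O.image fun s => s.getD 0 ∅) * sipmc κ (O.image fun s => s.getD 1 ∅) := by
  simp [sipmcSeq, Fin.prod_univ_two]

/-- An element of `y` in `C` lies in `B`, where `x` and `y` agree. With the two subtrees of a join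
as `C` and `D`, this recovers each part from the union. -/
theorem union_inter_eq_left {x y B C D : Finset V} (hx : x ⊆ C) (hy : y ⊆ D)
    (hB : ∀ z, z ∈ C → z ∈ D → z ∈ B) (hxy : x ∩ B = y ∩ B) : (x ∪ y) ∩ C = x := by
  refine Finset.Subset.antisymm (fun z hz => ?_)
    (Finset.subset_inter Finset.subset_union_left hx)
  obtain ⟨h1, h2⟩ := Finset.mem_inter.1 hz
  refine (Finset.mem_union.1 h1).elim id fun h3 => ?_
  have h4 : z ∈ y ∩ B := Finset.mem_inter.2 ⟨h3, hB z h2 (hy h3)⟩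
  exact (Finset.mem_inter.1 (hxy ▸ h4)).1

/-- The intersections with `P` of the parts below `t` of the models that restrict to `u` on the bag
of `t`. -/
noncomputable def parts (F : Formula V) (P : Finset V) (T : RootedTree N) (χ : N → Finset V) (t : N)
    (u : Row V) : Finset (Finset V) :=
  ((models F).filter fun J => J ∩ χ t = u).image fun J => J ∩ below F T χ t ∩ P

theorem mem_parts {t : N} {u : Row V} {x : Finset V} :
    x ∈ parts F P T χ t u ↔ ∃ J ∈ models F, J ∩ χ t = u ∧ J ∩ below F T χ t ∩ P = x := by
  simp [parts, and_assoc]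

theorem subset_below_of_mem_parts {t : N} {u : Row V} {x : Finset V}
    (hx : x ∈ parts F P T χ t u) : x ⊆ below F T χ t := by
  obtain ⟨J, -, -, rfl⟩ := mem_parts.1 hx
  exact Finset.inter_subset_left.trans Finset.inter_subset_right

namespace IsNiceTreeDecomposition

variable (h : IsNiceTreeDecomposition F T χ)
include h

/-- Each part determines `u ∩ P`, so rows from different buckets have no part in common. -/
theorem inter_bag_of_mem_parts {t : N} {u : Row V} {x : Finset V}
    (hx : x ∈ parts F P T χ t u) : x ∩ χ t = u ∩ P := by
  obtain ⟨J, -, rfl, rfl⟩ := mem_parts.1 hx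
  ext y
  have : y ∈ χ t → y ∈ below F T χ t := fun hy => h.bag_subset_below t hy
  simp only [Finset.mem_inter]
  tauto

theorem below_one {t c : N} (hc : T.children t = [c]) :
    below F T χ t = χ t ∪ below F T χ c := by
  ext x
  rw [h.mem_below_iff, hc]
  simp

theorem below_two {t c d : N} (hc : T.children t = [c, d]) (hcd : χ t = χ c) :
    below F T χ t = below F T χ c ∪ below F T χ d := by
  ext x
  have : x ∈ χ c → x ∈ below F T χ c := fun hx => h.bag_subset_below c hx
  rw [h.mem_below_iff, hc, hcd]
  simp only [List.mem_cons, List.not_mem_nil, or_false, exists_eq_or_imp, exists_eq_left,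
    Finset.mem_union]
  tauto

variable [Finite N] (hF : F ≠ {∅})
include hF

/-! ### Partial projected models across one node -/

/-- No variables are gained below a removal node, and its rows are restrictions of their origins, so
the two unions are equal as sets. -/
theorem card_biUnion_origs_of_removes {t c : N} (hc : T.children t = [c]) (hr : Removes χ t c)
    {σ : Table V} :
    ((origs F T χ (purgedSat F T χ) t σ).biUnion fun s => parts F P T χ c (s.getD 0 ∅)).card =
      (σ.biUnion (parts F P T χ t)).card := by
  have hb : below F T χ t = below F T χ c := by
    rw [h.below_one hc, Finset.union_eq_right]
    exact hr.1.trans (h.bag_subset_below c)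
  congr 1
  ext x
  simp only [Finset.mem_biUnion, origs, mem_orig_one hc, mem_parts, hb]
  constructor
  · rintro ⟨_, ⟨u, hu, r, hrc, rfl, hur⟩, J, hJ, hJr, rfl⟩
    simp only [List.getD_cons_zero] at hJr
    refine ⟨u, hu, J, hJ, ?_, rfl⟩
    rw [eq_inter_bag_of_mem_sat_of_removes hc hr (hJr ▸ Finset.inter_subset_right) hur, ← hJr,
      inter_bag_inter_bag hr.1]
  · rintro ⟨u, hu, J, hJ, rfl, rfl⟩
    exact ⟨[J ∩ χ c], ⟨_, hu, _, (h.mem_purgedSat hF).2 ⟨J, hJ, rfl⟩, rfl,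
      inter_bag_mem_sat_of_removes hc hr J⟩, J, hJ, rfl, rfl⟩

/-- The rows of `σ` agree on `P`, so every part at `t` arises from a part at `c` by adding the same
set `e`, which is disjoint from the variables below `c`. -/
theorem card_biUnion_origs_of_introduces {t c : N} (hc : T.children t = [c])
    (hi : Introduces χ t c) {σ : Table V} (hσ : σ ⊆ purgedSat F T χ t)
    (hP : ∀ u ∈ σ, ∀ w ∈ σ, u ∩ P = w ∩ P) :
    ((origs F T χ (purgedSat F T χ) t σ).biUnion fun s => parts F P T χ c (s.getD 0 ∅)).card =
      (σ.biUnion (parts F P T χ t)).card := by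
  rcases σ.eq_empty_or_nonempty with rfl | ⟨u₀, hu₀⟩
  · simp [origs]
  have hct : c ∈ T.children t := by simp [hc]
  have hb := h.below_one hc
  have hnew : ∀ x, x ∈ below F T χ c → x ∈ χ t → x ∈ χ c :=
    fun x => h.mem_bag_of_mem_below_child hct
  have hcc := h.bag_subset_below c
  -- Either empty or just the introduced variable.
  let e := (u₀ ∩ P) \ χ c
  have he : ∀ x ∈ below F T χ c, x ∉ e := by
    intro x hx hxe
    simp only [e, Finset.mem_sdiff, Finset.mem_inter] at hxe
    obtain ⟨J, -, hJ⟩ := (h.mem_purgedSat hF).1 (hσ hu₀)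
    rw [← hJ] at hxe
    exact hxe.2 (hnew x hx (Finset.mem_inter.1 hxe.1.1).2)
  have heσ : ∀ u ∈ σ, (u ∩ P) \ χ c = e := fun u hu => by rw [hP u hu u₀ hu₀]
  have key : ∀ J : Finset V, J ∩ χ t ∈ σ →
      J ∩ below F T χ t ∩ P = J ∩ below F T χ c ∩ P ∪ e := by
    intro J hJ
    rw [← heσ _ hJ, hb]
    ext x
    have h1 := hnew x
    have h2 := @hcc x
    simp only [Finset.mem_inter, Finset.mem_union, Finset.mem_sdiff]
    tauto
  have himage : σ.biUnion (parts F P T χ t) =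
      ((origs F T χ (purgedSat F T χ) t σ).biUnion fun s =>
        parts F P T χ c (s.getD 0 ∅)).image fun x => x ∪ e := by
    ext x
    simp only [Finset.mem_biUnion, Finset.mem_image, origs, mem_orig_one hc, mem_parts]
    constructor
    · rintro ⟨u, hu, J, hJ, rfl, rfl⟩
      exact ⟨_, ⟨[J ∩ χ c], ⟨_, hu, _, (h.mem_purgedSat hF).2 ⟨J, hJ, rfl⟩, rfl,
        inter_bag_mem_sat_of_introduces hc hi (mem_models.1 hJ).2⟩, J, hJ, rfl, rfl⟩,
        (key J hu).symm⟩
    · rintro ⟨_, ⟨_, ⟨u, hu, r, hrc, rfl, hur⟩, J, hJ, hJr, rfl⟩, rfl⟩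
      simp only [List.getD_cons_zero] at hJr
      obtain ⟨K, hK, rfl⟩ := (h.mem_purgedSat hF).1 (hσ hu)
      obtain ⟨h1, -, -⟩ := inter_bag_of_mem_sat_of_introduces hc hi
        (hJr ▸ Finset.inter_subset_right) hur
      -- `J` realises the part below `c` but need not restrict to `u`; gluing it below `c` with a
      -- model `K` that does gives both.
      have hKc : J ∩ χ c = K ∩ χ c := by
        rw [hJr, ← h1, Finset.inter_assoc, Finset.inter_eq_right.2 hi.1]
      have hL := h.glue_mem_models hJ hK hKc
      have hLt : (J ∩ below F T χ c ∪ K \ below F T χ c) ∩ χ t = K ∩ χ t := by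
        ext x
        have h3 := hnew x
        have h2 := @hcc x
        have h4 := Finset.ext_iff.1 hKc x
        simp only [Finset.mem_inter, Finset.mem_union, Finset.mem_sdiff] at h4 ⊢
        tauto
      refine ⟨_, hu, _, hL, hLt, ?_⟩
      rw [key _ (hLt ▸ hu)]
      congr 2
      ext x
      simp only [Finset.mem_inter, Finset.mem_union, Finset.mem_sdiff]
      tauto
  rw [himage, Finset.card_image_of_injOn]
  intro x hx y hy hxy
  have hsub : ∀ z ∈ (origs F T χ (purgedSat F T χ) t σ).biUnion fun s =>
      parts F P T χ c (s.getD 0 ∅), z ⊆ below F T χ c := by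
    intro z hz
    obtain ⟨s, -, hz⟩ := Finset.mem_biUnion.1 hz
    exact subset_below_of_mem_parts hz
  ext z
  have h1 := Finset.ext_iff.1 hxy z
  have h2 := he z
  have h3 := @hsub x hx z
  have h4 := @hsub y hy z
  simp only [Finset.mem_union] at h1
  tauto

/-- Taking unions maps the pairs bijectively onto the parts at `t`: gluing realises every pair of
parts of a common row, and intersecting with the variables below each child recovers the pair. -/
theorem card_biUnion_origs_of_join {t c d : N} (hc : T.children t = [c, d]) (hχc : χ t = χ c)
    (hχd : χ t = χ d) {σ : Table V} (hσ : σ ⊆ purgedSat F T χ t)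
    (hP : ∀ u ∈ σ, ∀ w ∈ σ, u ∩ P = w ∩ P) :
    ((origs F T χ (purgedSat F T χ) t σ).biUnion fun s =>
        parts F P T χ c (s.getD 0 ∅) ×ˢ parts F P T χ d (s.getD 1 ∅)).card =
      (σ.biUnion (parts F P T χ t)).card := by
  rcases σ.eq_empty_or_nonempty with rfl | ⟨u₀, hu₀⟩
  · simp [origs]
  have hct : c ∈ T.children t := by simp [hc]
  have hdt : d ∈ T.children t := by simp [hc]
  have hcd : c ≠ d := by
    have := T.nodup_children t
    rw [hc] at this
    simpa using this
  have hb := h.below_two hc hχc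
  have hsep : ∀ x, x ∈ below F T χ c → x ∈ below F T χ d → x ∈ χ t :=
    fun x => h.mem_bag_of_mem_below_of_siblings hct hdt hcd
  have hbc := h.bag_subset_below c
  have hbd := h.bag_subset_below d
  rw [← hχc] at hbc
  rw [← hχd] at hbd
  have hmem : ∀ p : Finset V × Finset V, p ∈ ((origs F T χ (purgedSat F T χ) t σ).biUnion fun s =>
        parts F P T χ c (s.getD 0 ∅) ×ˢ parts F P T χ d (s.getD 1 ∅)) ↔
      ∃ u ∈ σ, p.1 ∈ parts F P T χ c u ∧ p.2 ∈ parts F P T χ d u := by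
    rintro ⟨x, y⟩
    simp only [Finset.mem_biUnion, origs, mem_orig_two hc, Finset.mem_product]
    constructor
    · rintro ⟨_, ⟨u, hu, rfl, -, -⟩, hx, hy⟩
      exact ⟨u, hu, hx, hy⟩
    · rintro ⟨u, hu, hx, hy⟩
      obtain ⟨J, hJ, hJu⟩ := (h.mem_purgedSat hF).1 (hσ hu)
      exact ⟨[u, u], ⟨u, hu, rfl, (h.mem_purgedSat hF).2 ⟨J, hJ, hχc ▸ hJu⟩,
        (h.mem_purgedSat hF).2 ⟨J, hJ, hχd ▸ hJu⟩⟩, hx, hy⟩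
  have himage : σ.biUnion (parts F P T χ t) =
      ((origs F T χ (purgedSat F T χ) t σ).biUnion fun s =>
        parts F P T χ c (s.getD 0 ∅) ×ˢ parts F P T χ d (s.getD 1 ∅)).image fun p => p.1 ∪ p.2 := by
    ext x
    simp only [Finset.mem_image, hmem, Finset.mem_biUnion]
    simp only [mem_parts, Prod.exists]
    constructor
    · rintro ⟨u, hu, J, hJ, hJu, rfl⟩
      refine ⟨_, _, ⟨u, hu, ⟨J, hJ, hχc ▸ hJu, rfl⟩, J, hJ, hχd ▸ hJu, rfl⟩, ?_⟩
      rw [hb, Finset.inter_union_distrib_left, Finset.union_inter_distrib_right]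
    · rintro ⟨_, _, ⟨u, hu, ⟨J, hJ, hJu, rfl⟩, K, hK, hKu, rfl⟩, rfl⟩
      rw [← hχd] at hKu
      have hJK : J ∩ χ c = K ∩ χ c := by rw [hJu, ← hχc, hKu]
      rw [← hχc] at hJu
      have hJK' : J ∩ χ t = K ∩ χ t := by rw [hJu, hKu]
      -- Glued at `c`: `J` is used below `c` and `K` elsewhere.
      refine ⟨u, hu, _, h.glue_mem_models hJ hK hJK, ?_, ?_⟩
      · rw [← hKu]
        ext x
        have h2 := @hbc x
        have h4 := Finset.ext_iff.1 hJK' x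
        simp only [Finset.mem_inter, Finset.mem_union, Finset.mem_sdiff] at h4 ⊢
        tauto
      · rw [hb]
        ext x
        by_cases h2 : x ∈ below F T χ c
        · by_cases h3 : x ∈ below F T χ d
          · have h4 := Finset.ext_iff.1 hJK' x
            simp only [Finset.mem_inter, hsep x h2 h3, and_true] at h4
            simp [h2, h3, h4]
          · simp [h2, h3]
        · simp [h2]
  rw [himage, Finset.card_image_of_injOn]
  have hleft : ∀ p ∈ ((origs F T χ (purgedSat F T χ) t σ).biUnion fun s =>
        parts F P T χ c (s.getD 0 ∅) ×ˢ parts F P T χ d (s.getD 1 ∅)),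
      (p.1 ∪ p.2) ∩ below F T χ c = p.1 ∧ (p.1 ∪ p.2) ∩ below F T χ d = p.2 := by
    rintro ⟨x, y⟩ hp
    obtain ⟨u, hu, hx, hy⟩ := (hmem _).1 hp
    have h1 := subset_below_of_mem_parts hx
    have h2 := subset_below_of_mem_parts hy
    have h3 : x ∩ χ t = y ∩ χ t := by
      have h4 := h.inter_bag_of_mem_parts hx
      have h5 := h.inter_bag_of_mem_parts hy
      rw [← hχc] at h4
      rw [← hχd] at h5
      rw [h4, h5]
    refine ⟨union_inter_eq_left h1 h2 hsep h3, ?_⟩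
    rw [Finset.union_comm]
    exact union_inter_eq_left h2 h1 (fun z h5 h6 => hsep z h6 h5) h3.symm
  intro p hp q hq hpq
  obtain ⟨h1, h2⟩ := hleft p hp
  obtain ⟨h3, h4⟩ := hleft q hq
  have hpq : p.1 ∪ p.2 = q.1 ∪ q.2 := hpq
  rw [hpq] at h1 h2
  exact Prod.ext (h1.symm.trans h3) (h2.symm.trans h4)

/-- The counter stored for a set `σ` of rows at `t` is the number of partial projected models that
all rows of `σ` have in common. -/
theorem sipmc_dpProj (t : N) {σ : Table V} (hσ : σ ⊆ purgedSat F T χ t) (hne : σ.Nonempty) :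
    sipmc (dpProj F P T χ (purgedSat F T χ) t) σ = (inter σ (parts F P T χ t)).card := by
  induction t using T.wellFounded_child.induction generalizing σ with
  | _ t ih =>
    rw [dpProj, T.dp_eq, proj, sipmc_image]
    split_ifs with hmem
    · have hP := (mem_subBuckets.1 hmem).2.2
      by_cases hl : IsLeaf T t
      · have hσ0 : ∀ u ∈ σ, u = ∅ := by
          intro u hu
          obtain ⟨J, -, hJ⟩ := (h.mem_purgedSat hF).1 (hσ hu)
          rw [← hJ, h.bag_leaf t hl, Finset.inter_empty]
        obtain ⟨u, hu⟩ := hne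
        -- The leaf counter `1` is right only because a purged row witnesses a model; its part is
        -- then `∅`.
        obtain ⟨J, hJ, hJu⟩ := (h.mem_purgedSat hF).1 (hσ hu)
        rw [ipmc_eq, if_pos (by simpa [List.isEmpty_iff, IsLeaf] using hl), eq_comm, Finset.card_eq_one]
        refine ⟨∅, ?_⟩
        ext x
        rw [mem_inter ⟨u, hu⟩, Finset.mem_singleton]
        constructor
        · intro hx
          have := subset_below_of_mem_parts (hx u hu)
          rw [h.below_of_isLeaf hl] at this
          exact Finset.subset_empty.1 this
        · rintro rfl w hw
          rw [hσ0 w hw, mem_parts]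
          exact ⟨J, hJ, by rw [h.bag_leaf t hl, Finset.inter_empty], by simp [h.below_of_isLeaf hl]⟩
      · refine ipmc_eq_card_inter hl hne fun ρ hρ _ => ?_
        have hρσ := hρ.trans hσ
        have hρP : ∀ u ∈ ρ, ∀ w ∈ ρ, u ∩ P = w ∩ P := fun u hu w hw => hP u (hρ hu) w (hρ hw)
        rcases (h.node_type t).resolve_left hl with
          ⟨c, d, hc, hχc, hχd, -⟩ | hone
        · rw [← h.card_biUnion_origs_of_join hF hc hχc hχd hρσ hρP, hc]
          refine pcnt_eq_card_biUnion fun O hO hOne => ?_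
          simp only [List.map_cons, List.map_nil]
          rw [sipmcSeq_two, inter_product hOne, Finset.card_product,
            ← inter_image hOne (fun s : List (Row V) => s.getD 0 ∅),
            ← inter_image hOne (fun s : List (Row V) => s.getD 1 ∅)]
          have hO' : ∀ s ∈ O, ∃ u, s = [u, u] ∧ u ∈ purgedSat F T χ c ∧ u ∈ purgedSat F T χ d := by
            intro s hs
            obtain ⟨u, -, hu⟩ := Finset.mem_biUnion.1 (hO hs)
            exact ⟨u, (mem_orig_two hc).1 hu⟩
          congr 1
          · refine ih c (by simp [hc]) (fun r hr => ?_) (hOne.image _)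
            obtain ⟨s, hs, rfl⟩ := Finset.mem_image.1 hr
            obtain ⟨u, rfl, h1, h2⟩ := hO' s hs
            exact h1
          · refine ih d (by simp [hc]) (fun r hr => ?_) (hOne.image _)
            obtain ⟨s, hs, rfl⟩ := Finset.mem_image.1 hr
            obtain ⟨u, rfl, h1, h2⟩ := hO' s hs
            exact h2
        · obtain ⟨c, hc, hcard⟩ : ∃ c, T.children t = [c] ∧
              ((origs F T χ (purgedSat F T χ) t ρ).biUnion fun s =>
                parts F P T χ c (s.getD 0 ∅)).card = (ρ.biUnion (parts F P T χ t)).card := by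
            rcases hone with ⟨c, hc, hi⟩ | ⟨c, hc, hr⟩
            · exact ⟨c, hc, h.card_biUnion_origs_of_introduces hF hc hi hρσ hρP⟩
            · exact ⟨c, hc, h.card_biUnion_origs_of_removes hF hc hr⟩
          rw [← hcard, hc]
          refine pcnt_eq_card_biUnion fun O hO hOne => ?_
          simp only [List.map_cons, List.map_nil]
          rw [sipmcSeq_one, ← inter_image hOne (fun s : List (Row V) => s.getD 0 ∅)]
          -- When a variable of `P` is removed, the origins may differ on `P`. The induction
          -- hypothesis covers such sets too, with counter `0`.
          refine ih c (by simp [hc]) (fun r hr => ?_) (hOne.image _)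
          obtain ⟨s, hs, rfl⟩ := Finset.mem_image.1 hr
          obtain ⟨u, -, hu⟩ := Finset.mem_biUnion.1 (hO hs)
          obtain ⟨r, hrc, rfl, -⟩ := (mem_orig_one hc).1 hu
          exact hrc
    -- No counter is stored for `σ`; a common part would force its rows to agree on `P`.
    · rw [eq_comm, Finset.card_eq_zero, Finset.eq_empty_iff_forall_notMem]
      intro x hx
      rw [mem_inter hne] at hx
      refine hmem (mem_subBuckets.2 ⟨hne, hσ, fun u hu w hw => ?_⟩)
      rw [← h.inter_bag_of_mem_parts (hx u hu), ← h.inter_bag_of_mem_parts (hx w hw)]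

theorem sipmc_root (hP : P ⊆ vars F) :
    sipmc (dpProj F P T χ (purgedSat F T χ) T.root) (purgedSat F T χ T.root) =
        projectedModelCount F P ∧
      sipmc (dpProj F P T χ (purgedSat F T χ) T.root) {∅} = projectedModelCount F P := by
  have hmem : ∀ u, u ∈ purgedSat F T χ T.root ↔ (models F).Nonempty ∧ u = ∅ := by
    intro u
    rw [h.mem_purgedSat hF, h.bag_root]
    simp only [Finset.inter_empty]
    exact ⟨fun ⟨J, hJ, hu⟩ => ⟨⟨J, hJ⟩, hu.symm⟩, fun ⟨⟨J, hJ⟩, hu⟩ => ⟨J, hJ, hu.symm⟩⟩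
  by_cases hM : (models F).Nonempty
  · have hroot : purgedSat F T χ T.root = {∅} := by
      ext u
      simp [hmem, hM]
    rw [hroot, and_self, h.sipmc_dpProj hF T.root hroot.ge (Finset.singleton_nonempty _),
      projectedModelCount]
    congr 1
    ext x
    rw [mem_inter (Finset.singleton_nonempty _)]
    simp only [Finset.mem_singleton, forall_eq, mem_parts, h.bag_root, Finset.inter_empty, true_and,
      Finset.mem_image, h.below_root, Finset.inter_assoc, Finset.inter_eq_right.2 hP]
  -- If `F` is unsatisfiable, the root table is empty, so both lookups return the default `0`.
  · have hroot : purgedSat F T χ T.root = ∅ := by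
      ext u
      simp [hmem, hM]
    have hcount : projectedModelCount F P = 0 := by
      rw [projectedModelCount, Finset.not_nonempty_iff_eq_empty.1 hM]
      simp
    rw [hcount, dpProj, T.dp_eq, proj, sipmc_image, sipmc_image, hroot]
    simp [mem_subBuckets]

end IsNiceTreeDecomposition

end SecondPass


/-! ### Existence of a nice tree decomposition -/

section Existence

/-- The path with `m + 1` nodes, rooted at `0`. -/
def pathTree (m : ℕ) : RootedTree (Fin (m + 1)) where
  root := 0
  children t := if h : t.1 + 1 < m + 1 then [⟨t.1 + 1, h⟩] else []
  nodup_children t := by split_ifs <;> simp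
  root_notMem_children t := by
    intro h
    split_ifs at h
    · exact Nat.succ_ne_zero _ (Fin.ext_iff.1 (List.mem_singleton.1 h)).symm
    · simp at h
  parent_unique s t c hs ht := by
    have key : ∀ s : Fin (m + 1),
        c ∈ (if h : s.1 + 1 < m + 1 then [(⟨s.1 + 1, h⟩ : Fin (m + 1))] else []) →
          c.1 = s.1 + 1 := by
      intro s hs
      split_ifs at hs
      · rw [List.mem_singleton.1 hs]
      · simp at hs
    have h1 := key s hs
    have h2 := key t ht
    exact Fin.ext (by omega)
  reachable t := by
    obtain ⟨t, ht⟩ := t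
    induction t with
    | zero => exact Relation.ReflTransGen.refl
    | succ t ih => exact (ih (by omega)).tail (by simp [ht])

theorem mem_children_pathTree {m : ℕ} {s t : Fin (m + 1)} :
    s ∈ (pathTree m).children t ↔ s.1 = t.1 + 1 := by
  have := s.2
  simp only [pathTree]
  split_ifs with h
  · simp [Fin.ext_iff]
  · simp only [List.not_mem_nil, false_iff]
    omega

theorem pathTree_children_of_lt {m : ℕ} {t : Fin (m + 1)} (h : t.1 < m) :
    (pathTree m).children t = [⟨t.1 + 1, by omega⟩] := by
  simp [pathTree, h]

/-- A walk in a path visits all nodes between its ends. -/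
theorem mem_support_of_between {m : ℕ} {s t x : Fin (m + 1)} (p : (pathTree m).graph.Walk s t)
    (h : s ≤ x ∧ x ≤ t ∨ t ≤ x ∧ x ≤ s) : x ∈ p.support := by
  have key : ∀ {s t : Fin (m + 1)} (p : (pathTree m).graph.Walk s t), s ≤ x → x ≤ t →
      x ∈ p.support := by
    intro s t p hs ht
    rcases eq_or_lt_of_le ht with rfl | ht
    · exact p.end_mem_support
    -- Adjacent nodes differ by one, so the edge leaving `{y | y ≤ x}` starts at `x`.
    obtain ⟨d, hd, h1, h2⟩ := p.exists_boundary_dart {y | y ≤ x} hs (not_le.2 ht)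
    have h1 : d.fst ≤ x := h1
    have h2 : ¬ d.snd ≤ x := h2
    have hadj := ((SimpleGraph.fromRel_adj _ _ _).1 d.adj).2
    rw [mem_children_pathTree, mem_children_pathTree] at hadj
    have : d.fst = x := by
      rw [Fin.le_def] at h1 h2
      apply Fin.ext
      omega
    rw [← this]
    exact p.dart_fst_mem_support_of_mem_darts hd
  rcases h with h | h
  · exact key p h.1 h.2
  · have := key p.reverse h.1 h.2
    rwa [SimpleGraph.Walk.support_reverse, List.mem_reverse] at this

/-- Were `s` outside the interval spanned by the ends, the walk from one end to `s` would pass over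
the other end, which a path visits only once. -/
theorem between_of_mem_support {m : ℕ} {r s t : Fin (m + 1)} (p : (pathTree m).graph.Walk r t)
    (hp : p.IsPath) (hs : s ∈ p.support) : min r t ≤ s ∧ s ≤ max r t := by
  have h1 : t ≠ s → t ∉ (p.takeUntil s hs).support :=
    SimpleGraph.Walk.endpoint_notMem_support_takeUntil hp hs
  have hs' : s ∈ p.reverse.support := by simpa using hs
  have h2 : r ≠ s → r ∉ (p.reverse.takeUntil s hs').support :=
    SimpleGraph.Walk.endpoint_notMem_support_takeUntil hp.reverse hs'
  have h3 : t ≠ s → ¬ (r ≤ t ∧ t ≤ s ∨ s ≤ t ∧ t ≤ r) :=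
    fun h h' => h1 h (mem_support_of_between _ h')
  have h4 : r ≠ s → ¬ (t ≤ r ∧ r ≤ s ∨ s ≤ r ∧ r ≤ t) :=
    fun h h' => h2 h (mem_support_of_between _ h')
  simp only [ne_eq, Fin.ext_iff, Fin.le_def, min_le_iff, le_max_iff] at h3 h4 ⊢
  omega

variable {V : Type u} [DecidableEq V]

/-- The bags along a path on which the elements of `l` are introduced and then removed. -/
def pathBag (l : List V) (t : Fin (2 * l.length + 1)) : Finset V :=
  (l.take (min t.1 (2 * l.length - t.1))).toFinset

theorem isNiceTreeDecomposition_pathTree (F : Formula V) :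
    IsNiceTreeDecomposition F (pathTree (2 * (vars F).toList.length)) (pathBag (vars F).toList) := by
  set l := (vars F).toList with hl
  have hnd : l.Nodup := Finset.nodup_toList _
  have hmono : ∀ {i j : ℕ}, i ≤ j → (l.take i).toFinset ⊆ (l.take j).toFinset := by
    intro i j hij x hx
    rw [List.mem_toFinset] at hx ⊢
    exact (List.take_prefix_take_left hij).subset hx
  have hcard : ∀ {i : ℕ}, i ≤ l.length → (l.take i).toFinset.card = i := by
    intro i hi
    rw [List.toFinset_card_of_nodup (hnd.sublist (List.take_sublist _ _)), List.length_take]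
    omega
  have hmid : ∀ x ∈ vars F, x ∈ pathBag l ⟨l.length, by omega⟩ := by
    intro x hx
    have : min l.length (2 * l.length - l.length) = l.length := by omega
    simp only [pathBag, this, List.take_length, List.mem_toFinset]
    exact Finset.mem_toList.2 hx
  refine ⟨⟨?_, fun x hx => ⟨_, hmid x hx⟩, ?_, ?_⟩, ?_, ?_, ?_⟩
  · intro t x hx
    rw [pathBag, List.mem_toFinset] at hx
    exact Finset.mem_toList.1 (List.mem_of_mem_take hx)
  · rintro x y ⟨-, c, hc, hx, hy⟩
    have := Finset.subset_biUnion_of_mem clauseVars hc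
    exact ⟨_, hmid x (this hx), hmid y (this hy)⟩
  · intro r s t p hp hs
    obtain ⟨h1, h2⟩ := between_of_mem_support p hp hs
    simp only [min_le_iff, le_max_iff, Fin.le_def] at h1 h2
    -- Bags are prefixes of `l` whose length rises and then falls along the path, so the bag at `s`
    -- contains the smaller of the two end bags.
    by_cases hrt : min r.1 (2 * l.length - r.1) ≤ min s.1 (2 * l.length - s.1)
    · exact Finset.inter_subset_left.trans (hmono hrt)
    · exact Finset.inter_subset_right.trans (hmono (by omega))
  · intro t
    by_cases ht : t.1 < 2 * l.length
    · have hc := pathTree_children_of_lt ht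
      right; right
      -- In the half near the root the child has the larger bag (removal); in the other half it has
      -- the smaller one (introduction).
      by_cases ht' : t.1 < l.length
      · right
        refine ⟨_, hc, hmono (by simp only; omega), ?_⟩
        rw [pathBag, pathBag, hcard (by omega), hcard (by omega)]
        simp only
        omega
      · left
        refine ⟨_, hc, hmono (by simp only; omega), ?_⟩
        rw [pathBag, pathBag, hcard (by omega), hcard (by omega)]
        simp only
        omega
    · left
      simp only [IsLeaf, pathTree]
      rw [dif_neg (by omega)]
  · intro t ht
    have htl : ¬ t.1 < 2 * l.length := by
      intro h
      rw [IsLeaf, pathTree_children_of_lt h] at ht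
      simp at ht
    have : min t.1 (2 * l.length - t.1) = 0 := by omega
    simp [pathBag, this]
  · simp [pathBag, pathTree]

end Existence

end ProjCount

theorem mainTheorem3 {V : Type*} [DecidableEq V] (F : ProjCount.Formula V) (hF : F ≠ {∅})
    (P : Finset V) (hP : P ⊆ ProjCount.vars F) :
    (∀ {N : Type*} [Finite N] (T : ProjCount.RootedTree N) (χ : N → Finset V),
      ProjCount.IsNiceTreeDecomposition F T χ →
        ProjCount.sipmc
            (ProjCount.dpProj F P T χ (ProjCount.purgedSat F T χ) T.root)
            (ProjCount.purgedSat F T χ T.root)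
          = ProjCount.projectedModelCount F P ∧
        ProjCount.sipmc
            (ProjCount.dpProj F P T χ (ProjCount.purgedSat F T χ) T.root) {∅}
          = ProjCount.projectedModelCount F P) ∧
    (∀ c : ℕ, ProjCount.MdpOutputs F P c ↔ c = ProjCount.projectedModelCount F P) := by
  refine ⟨fun T χ h => h.sipmc_root hF hP, fun c => ⟨?_, ?_⟩⟩
  · rintro ⟨m, T, χ, h, rfl⟩
    exact (h.sipmc_root hF hP).1
  · rintro rfl
    exact ⟨_, _, _, ProjCount.isNiceTreeDecomposition_pathTree F,
      ((ProjCount.isNiceTreeDecomposition_pathTree F).sipmc_root hF hP).1⟩
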